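/- **Setting.** Fix $\varphi>0$, $\eta_1>1$, $\eta_2>\frac{3\eta_1-1}{\eta_1-1}$, $0<\vartheta<\frac{(\eta_1-1)(\eta_2-1)-2\eta_1}{1+(2\eta_1-1)\eta_2}$, $0<\xi<\vartheta$, $c>1$, and $d_1$ with $\frac{1+\vartheta}{(1-\vartheta)(\eta_2-1)}+\frac1{\eta_1}<d_1<\frac{1-2\vartheta}{2(1-\vartheta)}+\frac1{2\eta_1}$ and $(\eta_2+3)d_1-\frac{\eta_2+1}{\eta_1}-3>0$. Fix also bounds $C_{K_1},C_{K_2},L_{K_1},L_{K_2}$ and $B$. For $1\le t\le T$ let $Y_{t,T}=m^\star(t/T,X_{t,T})+\varepsilon_{t,T}$, where $X_{t,T}$ takes values in a compact subset of $\mathbb R^d$ ($d\ge1$), $m^\star$ is measurable and $\mathbb E[\varepsilon_{t,T}\mid X_{t,T}]=0$. Assume: * $\{X_{t,T}\}$ is locally stationary: for each $u\in[0,1]$ there is a strictly stationary process $\{X_t(u)\}_{t\in\mathbb Z}$ with $\|X_{t,T}-X_t(u)\|\le(|t/T-u|+1/T)\,U_{t,T}(u)$ a.s., where $U_{t,T}(u)>0$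 and $\mathbb E[U_{t,T}(u)^\rho]<C'$ for some $\rho>0$, $C'<\infty$ independent of $u,t,T$; * the coefficients $\beta(k)=\sup_{1\le t\le T-k}\beta\big(\sigma(Z_{s,T},1\le s\le t),\sigma(Z_{s,T},t+k\le s\le T)\big)$ of $Z_{t,T}=(X_{t,T},\varepsilon_{t,T})$, with $\beta(\mathcal A,\mathcal B)=\mathbb E\sup_{B\in\mathcal B}|\mathbb P(B)-\mathbb P(B\mid\mathcal A)|$ (essential supremum), satisfy $\beta(k)\le\exp(-\varphi k^{\eta_1})$; * the kernels $K_i$ ($i=1,2$) are even, bounded by $C_{K_i}$, vanish outside $[-1,1]$ and are Lipschitz with constant $L_{K_i}$; * $\mathbb P[|\varepsilon_{t,T}|>v]=v^{-\eta_2}L(v)$ for all $v>0$, where $L$ is slowly varying at $\infty$ and $L\le B$ on $(0,\infty)$; * the bandwidth $h=h(T)>0$ satisfies $h=O(T^{-\xi})$. For $\boldsymbol\theta\in\mathbb R^{Td}$ put $m_{\boldsymbol\theta}(u,x)=\sum_{r=1}^T\sum_{j=1}^d\theta_{r,j}K_1\big(\tfrac{u-r/T}{h}\big)K_2\big(\tfrac{x^j-X^j_{r,T}}{h}\big)$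 and $R(m_{\boldsymbol\theta},m^\star)=\frac1T\sum_{t=1}^T\big(m_{\boldsymbol\theta}(\tfrac tT,X_{t,T})-m^\star(\tfrac tT,X_{t,T})\big)^2$, and let $\hat m=m_{\hat{\boldsymbol\theta}}$ for any minimiser $\hat{\boldsymbol\theta}$ over $\mathbb R^{Td}$ of $\frac1T\sum_{t=1}^T\big(Y_{t,T}-m_{\boldsymbol\theta}(\tfrac tT,X_{t,T})\big)^2+\lambda\|\boldsymbol\theta\|_1$. **Theorem (Lasso, slow rate, regularly varying noise).** There are a constant $C_0>0$ and integers $T_0(C)$, $C>0$, with $T_0(C)=1$ whenever $C\ge C_0$, all depending only on $\varphi,\eta_1,\eta_2,\vartheta,\xi,d_1,c,C_{K_1},C_{K_2},L_{K_1},L_{K_2},B$, such that the following holds for every $C_{K,L}>0$, every $d\ge 1$ and every model as above. If $T\ge T_0(C_{K,L})$, $$T>\Big(\frac{d^{\,c(2+1/\eta_1-2d_1)}}{(c\log d)^{(d_1-1/\eta_1)(\eta_2-1)+1}}\Big)^{\frac1{(\eta_2+3)d_1-(\eta_2+1)/\eta_1-3}}\qquad\text{and}\qquad \lambda=\frac{2C_{K,L}(2T+1)}{T^{1+\vartheta-\xi}},$$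 then with probability at least $1-d^{1-c}$ $$R(\hat m,m^\star)\le\inf_{\boldsymbol\theta\in\mathbb R^{Td}}\big\{R(m_{\boldsymbol\theta},m^\star)+2\lambda\|\boldsymbol\theta\|_1\big\}.$$ (For $d=1$ the probability bound is trivial.) In particular, if $C_{K,L}\ge C_0$ no lower bound on $T$ other than the displayed one is needed. -/

import Mathlib

open MeasureTheory Filter Topology Asymptotics
open scoped ENNReal

namespace LSTS

/-- A process indexed by `ℤ` is strictly stationary: its law is invariant under every time shift. -/
def IsStrictlyStationary {Ω E : Type*} [MeasurableSpace Ω] [MeasurableSpace E]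
    (μ : Measure Ω) (S : ℤ → Ω → E) : Prop :=
  (∀ t, Measurable (S t)) ∧
    ∀ s : ℤ, μ.map (fun ω (t : ℤ) => S (t + s) ω) = μ.map (fun ω (t : ℤ) => S t ω)

/-- The array `X t T` (with `1 ≤ t ≤ T`) is locally stationary. The norm on `ℝ^d` is the sup norm;
as all norms on `ℝ^d` are equivalent, another norm only rescales `U` and `C`. -/
def IsLocallyStationary {Ω : Type*} [MeasurableSpace Ω] (μ : Measure Ω) {d : ℕ}
    (X : ℕ → ℕ → Ω → Fin d → ℝ) : Prop :=
  ∃ ρ C : ℝ, 0 < ρ ∧ ∃ (S : ℝ → ℤ → Ω → Fin d → ℝ) (U : ℕ → ℕ → ℝ → Ω → ℝ),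
    ∀ u ∈ Set.Icc (0 : ℝ) 1, IsStrictlyStationary μ (S u) ∧
      ∀ T t : ℕ, 1 ≤ t → t ≤ T →
        Measurable (U t T u) ∧ (∀ ω, 0 < U t T u ω) ∧
        Integrable (fun ω => U t T u ω ^ ρ) μ ∧ ∫ ω, U t T u ω ^ ρ ∂μ < C ∧
        ∀ᵐ ω ∂μ, ‖X t T ω - S u (t : ℤ) ω‖ ≤ (|(t : ℝ) / T - u| + 1 / (T : ℝ)) * U t T u ω

/-- `β(𝒜, ℬ) = 𝔼 [ sup_{B ∈ ℬ} |ℙ(B) - ℙ(B | 𝒜)| ]`. Conditional probabilities are defined up to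
null sets, so the supremum is the essential one, that is, the smallest (up to null sets) measurable
`g` that dominates `|ℙ(B) - ℙ(B | 𝒜)|` almost surely for each `B ∈ ℬ`; its expectation is the
infimum of the expectations of all such `g`. -/
noncomputable def betaDependence {Ω : Type*} [mΩ : MeasurableSpace Ω] (μ : Measure Ω)
    (𝒜 ℬ : MeasurableSpace Ω) : ℝ≥0∞ :=
  ⨅ g ∈ {g : Ω → ℝ≥0∞ | Measurable[mΩ] g ∧ ∀ B : Set Ω, MeasurableSet[ℬ] B →
      ∀ᵐ ω ∂μ, ENNReal.ofReal |μ.real B - (μ[B.indicator (fun _ => (1 : ℝ)) | 𝒜]) ω| ≤ g ω},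
    ∫⁻ ω, g ω ∂μ

/-- The `σ`-field generated by `Z s T`, `a ≤ s ≤ b`. -/
@[reducible] def sigmaBlock {Ω E : Type*} [MeasurableSpace E] (Z : ℕ → ℕ → Ω → E) (T a b : ℕ) :
    MeasurableSpace Ω :=
  ⨆ s ∈ Finset.Icc a b, MeasurableSpace.comap (Z s T) inferInstance

/-- The `β`-mixing coefficient `β(k)` of the array `Z t T`, `1 ≤ t ≤ T`. -/
noncomputable def betaMixing {Ω E : Type*} [MeasurableSpace Ω] [MeasurableSpace E]
    (μ : Measure Ω) (Z : ℕ → ℕ → Ω → E) (k : ℕ) : ℝ≥0∞ :=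
  ⨆ (T : ℕ) (t : ℕ) (_ : 1 ≤ t) (_ : t + k ≤ T),
    betaDependence μ (sigmaBlock Z T 1 t) (sigmaBlock Z T (t + k) T)

/-- `L(s v) ∼ L(v)` as `v → ∞`, for all `s > 0`. -/
def SlowlyVarying (L : ℝ → ℝ) : Prop :=
  ∀ s : ℝ, 0 < s → Tendsto (fun v => L (s * v) / L v) atTop (𝓝 1)

/-- `ℙ(|H| > v) = v ^ (-η) L(v)` for all `v > 0`, with `L` slowly varying. -/
def HasRegularlyVaryingTail {Ω : Type*} [MeasurableSpace Ω] (μ : Measure Ω) (H : Ω → ℝ)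
    (η : ℝ) (L : ℝ → ℝ) : Prop :=
  SlowlyVarying L ∧ ∀ v : ℝ, 0 < v → μ.real {ω | v < |H ω|} = v ^ (-η) * L v

/-- A basic kernel: even, bounded by `CK`, supported in `[-1, 1]`, Lipschitz with constant `LK`. -/
structure IsBasicKernel (K : ℝ → ℝ) (CK LK : ℝ) : Prop where
  even : ∀ v, K (-v) = K v
  bounded : ∀ v, |K v| ≤ CK
  support : ∀ v, 1 < |v| → K v = 0
  lipschitz : ∀ v v', |K v - K v'| ≤ LK * |v - v'|

/-- The model `Y t T = m⋆ (t / T, X t T) + ε t T`, `1 ≤ t ≤ T`, with covariates in a compact set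
and with `m⋆` the conditional mean of the response given the covariates: `𝔼[ε t T | X t T] = 0`. -/
structure IsRegressionModel {Ω : Type*} [MeasurableSpace Ω] (μ : Measure Ω) {d : ℕ}
    (𝒳 : Set (Fin d → ℝ)) (mstar : ℝ → (Fin d → ℝ) → ℝ)
    (X : ℕ → ℕ → Ω → Fin d → ℝ) (ε Y : ℕ → ℕ → Ω → ℝ) : Prop where
  compact : IsCompact 𝒳
  measurable_mstar : Measurable (fun p : ℝ × (Fin d → ℝ) => mstar p.1 p.2)
  measurable_X : ∀ T t : ℕ, 1 ≤ t → t ≤ T → Measurable (X t T)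
  measurable_noise : ∀ T t : ℕ, 1 ≤ t → t ≤ T → Measurable (ε t T)
  mem : ∀ T t : ℕ, 1 ≤ t → t ≤ T → ∀ ω, X t T ω ∈ 𝒳
  model : ∀ T t : ℕ, 1 ≤ t → t ≤ T → ∀ ω,
    Y t T ω = mstar ((t : ℝ) / T) (X t T ω) + ε t T ω
  integrable_noise : ∀ T t : ℕ, 1 ≤ t → t ≤ T → Integrable (ε t T) μ
  condMean : ∀ T t : ℕ, 1 ≤ t → t ≤ T →
    μ[ε t T | MeasurableSpace.comap (X t T) inferInstance] =ᵐ[μ] 0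

/-- The candidate `m_θ (u, z) = ∑_{r=1}^T ∑_{j=1}^d θ_{r,j} K₁((u - r/T)/h) K₂((z^j - x_r^j)/h)`
built on the covariates `x 1, …, x T`; the row `r` of `θ ∈ ℝ^{Td}` has the index `r - 1 : Fin T`. -/
noncomputable def candidate {d : ℕ} (K₁ K₂ : ℝ → ℝ) (h : ℝ) (T : ℕ) (x : ℕ → Fin d → ℝ)
    (θ : Fin T → Fin d → ℝ) (u : ℝ) (z : Fin d → ℝ) : ℝ :=
  ∑ r : Fin T, ∑ j : Fin d,
    θ r j * K₁ ((u - ((r : ℕ) + 1 : ℕ) / (T : ℝ)) / h) * K₂ ((z j - x ((r : ℕ) + 1) j) / h)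

/-- The empirical risk `R_T(θ) = (1/T) ∑_{t=1}^T (y_t - m_θ(t/T, x_t))²`. -/
noncomputable def empiricalRisk {d : ℕ} (K₁ K₂ : ℝ → ℝ) (h : ℝ) (T : ℕ) (x : ℕ → Fin d → ℝ)
    (y : ℕ → ℝ) (θ : Fin T → Fin d → ℝ) : ℝ :=
  1 / (T : ℝ) * ∑ t ∈ Finset.Icc 1 T, (y t - candidate K₁ K₂ h T x θ ((t : ℝ) / T) (x t)) ^ 2

/-- The prediction risk `R(m_θ, m⋆) = (1/T) ∑_{t=1}^T (m_θ(t/T, x_t) - m⋆(t/T, x_t))²`. -/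
noncomputable def predictionRisk {d : ℕ} (K₁ K₂ : ℝ → ℝ) (h : ℝ) (T : ℕ) (x : ℕ → Fin d → ℝ)
    (mstar : ℝ → (Fin d → ℝ) → ℝ) (θ : Fin T → Fin d → ℝ) : ℝ :=
  1 / (T : ℝ) * ∑ t ∈ Finset.Icc 1 T,
    (candidate K₁ K₂ h T x θ ((t : ℝ) / T) (x t) - mstar ((t : ℝ) / T) (x t)) ^ 2

/-- `‖θ‖₁`. -/
def l1Norm {T d : ℕ} (θ : Fin T → Fin d → ℝ) : ℝ := ∑ r, ∑ j, |θ r j|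

/-- `θhat` minimises `θ ↦ R_T(θ) + lam * ‖θ‖₁` over `ℝ^{Td}`. -/
def IsLassoEstimator {d : ℕ} (K₁ K₂ : ℝ → ℝ) (h lam : ℝ) (T : ℕ) (x : ℕ → Fin d → ℝ)
    (y : ℕ → ℝ) (θhat : Fin T → Fin d → ℝ) : Prop :=
  ∀ θ : Fin T → Fin d → ℝ,
    empiricalRisk K₁ K₂ h T x y θhat + lam * l1Norm θhat ≤
      empiricalRisk K₁ K₂ h T x y θ + lam * l1Norm θ

/-- The lower bound on the sample size, as a function of the dimension. -/
noncomputable def sampleSizeBound (η₁ η₂ d₁ c : ℝ) (d : ℕ) : ℝ :=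
  ((d : ℝ) ^ (c * (2 + 1 / η₁ - 2 * d₁)) /
      (c * Real.log d) ^ ((d₁ - 1 / η₁) * (η₂ - 1) + 1)) ^
    (1 / ((η₂ + 3) * d₁ - (η₂ + 1) / η₁ - 3))

/-- The tuning parameter `λ = 2 C (2T + 1) / T^{1 + ϑ - ξ}`. -/
noncomputable def tuning (C ϑ ξ : ℝ) (T : ℕ) : ℝ :=
  2 * C * (2 * (T : ℝ) + 1) / (T : ℝ) ^ (1 + ϑ - ξ)

end LSTS

/-! On the event that every noise interaction, scaled by 2/T, is at most λ, the oracle inequality is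
deterministic (`predictionRisk_le_of_isLassoEstimator`). Since λ ≥ 4C T^(ξ-ϑ), it suffices to bound
the Td interactions by 2C T^(1+ξ-ϑ) outside an event of probability d^(1-c).

An interaction is a sum of dependent, heavy-tailed terms whose kernel is centred at the random point
X_r. The noise is truncated at T^a; because 𝔼[ε | X] = 0, the truncated terms with a fixed centre
have a mean governed by the tail alone (`abs_integral_clamped_noise_le`). The joint law of past and
future exceeds the product of its marginals by at most the β-dependence
(`map_prod_le_add_betaDependence`). This is used twice: to freeze X_r in the terms at distance at
least k from r, and to compare the terms of a residue class modulo k with independent ones, for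
which Hoeffding's inequality holds. The fewer than 2k terms near r are bounded trivially
(`measure_abs_sum_random_parameter_gt_le`).

With k of order T^(ξ/4), the Hoeffding and mixing errors decay like exp(-c₁ T^(ξ/4)), which beats
the union bound over Td elements. The one polynomial error is the probability, of order T^(1-aη₂),
that some noise exceeds the truncation level. The sample size condition amounts to d^(c-1) ≤ M T^w
(`rpow_sub_one_le_of_sampleSizeBound_lt`), and w < aη₂ - 1 by `parameter_bounds`, so this error is
below d^(1-c) for large T (`eventually_exists_truncation`). The remaining small T are bounded by a
constant; there a fixed bound on the largest noise suffices once C ≥ C₀. -/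

namespace LSTS

/-! ### Joint laws against product laws, through the β-dependence. -/

/-- Sets `{p | p.2 ∈ B (N p.1)}` with `N` measurable and finitely valued: the algebra generated by
measurable rectangles. -/
def rectangleAlgebra (E F : Type*) [MeasurableSpace E] [MeasurableSpace F] : Set (Set (E × F)) :=
  {S | ∃ (n : ℕ) (N : E → Fin n) (B : Fin n → Set F), Measurable N ∧
    (∀ i, MeasurableSet (B i)) ∧ S = {p | p.2 ∈ B (N p.1)}}

/-- For a union, the pair of labels `(N x, N' x)` gives the common refinement of the two partitions.
-/
lemma isSetAlgebra_rectangleAlgebra (E F : Type*) [MeasurableSpace E] [MeasurableSpace F] :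
    IsSetAlgebra (rectangleAlgebra E F) where
  empty_mem := ⟨1, fun _ => 0, fun _ => ∅, measurable_const, fun _ => .empty, by ext; simp⟩
  compl_mem := by
    rintro _ ⟨n, N, B, hN, hB, rfl⟩
    exact ⟨n, N, fun i => (B i)ᶜ, hN, fun i => (hB i).compl, by ext; simp⟩
  union_mem := by
    rintro _ _ ⟨n, N, B, hN, hB, rfl⟩ ⟨n', N', B', hN', hB', rfl⟩
    refine ⟨n * n', fun x => finProdFinEquiv (N x, N' x),
      fun i => B (finProdFinEquiv.symm i).1 ∪ B' (finProdFinEquiv.symm i).2, ?_,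
      fun i => (hB _).union (hB' _), ?_⟩
    · exact (measurable_of_countable (f := fun p : Fin n × Fin n' => finProdFinEquiv p)).comp
        (hN.prodMk hN')
    · ext p
      simp only [Equiv.symm_apply_apply]
      rfl

lemma measurableSet_of_mem_rectangleAlgebra {E F : Type*} [MeasurableSpace E] [MeasurableSpace F]
    {S : Set (E × F)} (hS : S ∈ rectangleAlgebra E F) : MeasurableSet S := by
  obtain ⟨n, N, B, hN, hB, rfl⟩ := hS
  have : {p : E × F | p.2 ∈ B (N p.1)} = ⋃ i, (N ⁻¹' {i}) ×ˢ B i := by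
    ext p; simp
  rw [this]
  exact MeasurableSet.iUnion fun i => (hN (measurableSet_singleton i)).prod (hB i)

lemma generateFrom_rectangleAlgebra (E F : Type*) [MeasurableSpace E] [MeasurableSpace F] :
    (inferInstance : MeasurableSpace (E × F)) =
      MeasurableSpace.generateFrom (rectangleAlgebra E F) := by
  classical
  apply le_antisymm
  · rw [← generateFrom_prod]
    apply MeasurableSpace.generateFrom_mono
    rintro _ ⟨s, hs, t, ht, rfl⟩
    refine ⟨2, fun x => if x ∈ s then 1 else 0, fun i => if i = 1 then t else ∅,
      Measurable.ite hs measurable_const measurable_const, fun i => ?_, ?_⟩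
    · dsimp only; split_ifs
      exacts [ht, .empty]
    · ext p
      by_cases h : p.1 ∈ s <;> simp [h]
  · exact MeasurableSpace.generateFrom_le fun S hS => measurableSet_of_mem_rectangleAlgebra hS

section decoupling

open scoped symmDiff

variable {Ω E F : Type*} {𝒜 ℬ mΩ : MeasurableSpace Ω} {μ : Measure Ω} [IsProbabilityMeasure μ]
  [MeasurableSpace E] [MeasurableSpace F] {U : Ω → E} {V : Ω → F}

/-- Integrate ℙ(B | 𝒜) ≤ ℙ(B) + g over A. Keeping the error localised on A is what lets the errors
of disjoint sets A add up to one `∫⁻ g`. -/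
lemma measure_inter_le_of_dominates (h𝒜 : 𝒜 ≤ mΩ) (hℬ : ℬ ≤ mΩ) {g : Ω → ℝ≥0∞}
    {A B : Set Ω} (hA : MeasurableSet[𝒜] A) (hB : MeasurableSet[ℬ] B)
    (hg : ∀ᵐ ω ∂μ, ENNReal.ofReal |μ.real B - (μ[B.indicator (fun _ => (1 : ℝ)) | 𝒜]) ω| ≤ g ω) :
    μ (A ∩ B) ≤ μ A * μ B + ∫⁻ ω in A, g ω ∂μ := by
  set f := μ[B.indicator (fun _ => (1 : ℝ)) | 𝒜] with hf
  have hint : Integrable (B.indicator (fun _ => (1 : ℝ))) μ :=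
    (integrable_const 1).indicator (hℬ _ hB)
  have h1 : ∫ ω in A, f ω ∂μ = μ.real (A ∩ B) := by
    rw [hf, setIntegral_condExp h𝒜 hint hA, integral_indicator (hℬ _ hB)]
    simp [measureReal_restrict_apply (hℬ _ hB), Set.inter_comm]
  have hnn : 0 ≤ᵐ[μ] f := condExp_nonneg (ae_of_all _ fun ω => Set.indicator_nonneg (by simp) _)
  have h2 : μ (A ∩ B) = ∫⁻ ω in A, ENNReal.ofReal (f ω) ∂μ := by
    rw [← ofReal_integral_eq_lintegral_ofReal integrable_condExp.restrict
      (ae_restrict_of_ae hnn), h1, ofReal_measureReal]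
  rw [h2]
  calc ∫⁻ ω in A, ENNReal.ofReal (f ω) ∂μ ≤ ∫⁻ ω in A, (μ B + g ω) ∂μ := by
        apply lintegral_mono_ae
        filter_upwards [ae_restrict_of_ae hg] with ω hω
        calc ENNReal.ofReal (f ω) ≤ ENNReal.ofReal (μ.real B + |μ.real B - f ω|) := by
              apply ENNReal.ofReal_le_ofReal
              linarith [neg_abs_le (μ.real B - f ω)]
          _ = μ B + ENNReal.ofReal |μ.real B - f ω| := by
              rw [ENNReal.ofReal_add measureReal_nonneg (abs_nonneg _), ofReal_measureReal]
          _ ≤ _ := by gcongr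
    _ = μ A * μ B + ∫⁻ ω in A, g ω ∂μ := by
        rw [lintegral_add_left measurable_const, setLIntegral_const, mul_comm]

/-- The cells `U ⁻¹' (N ⁻¹' {i})` partition Ω, and a single g dominates for all the sets `V ⁻¹' (B
i)`, so the total error does not grow with the number of cells. -/
lemma measure_rectangleAlgebra_le (h𝒜 : 𝒜 ≤ mΩ) (hℬ : ℬ ≤ mΩ) (hU : Measurable[𝒜] U)
    (hV : Measurable[ℬ] V) {S : Set (E × F)} (hS : S ∈ rectangleAlgebra E F) :
    μ.map (fun ω => (U ω, V ω)) S ≤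
      (μ.map U).prod (μ.map V) S + betaDependence μ 𝒜 ℬ := by
  have hSm := measurableSet_of_mem_rectangleAlgebra hS
  have hU' : Measurable U := hU.mono h𝒜 le_rfl
  have hV' : Measurable V := hV.mono hℬ le_rfl
  rw [← tsub_le_iff_left]
  refine le_iInf₂ fun g hg => ?_
  obtain ⟨hgm, hg⟩ := hg
  rw [tsub_le_iff_left]
  obtain ⟨n, N, B, hN, hB, rfl⟩ := hS
  have : IsProbabilityMeasure (μ.map V) := Measure.isProbabilityMeasure_map hV'.aemeasurable
  have hA : ∀ i, MeasurableSet[𝒜] (U ⁻¹' (N ⁻¹' {i})) := fun i =>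
    hU (hN (measurableSet_singleton i))
  have hdisj : Pairwise (Function.onFun Disjoint fun i => U ⁻¹' (N ⁻¹' {i})) := fun i j hij =>
    Set.disjoint_left.2 fun ω h h' => hij (by simp_all)
  rw [Measure.map_apply (hU'.prodMk hV') hSm]
  have e1 : (fun ω => (U ω, V ω)) ⁻¹' {p : E × F | p.2 ∈ B (N p.1)} =
      ⋃ i, (U ⁻¹' (N ⁻¹' {i})) ∩ V ⁻¹' (B i) := by
    ext ω; simp
  have e2 : {p : E × F | p.2 ∈ B (N p.1)} = ⋃ i, (N ⁻¹' {i}) ×ˢ B i := by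
    ext p; simp
  have e3 : (μ.map U).prod (μ.map V) {p : E × F | p.2 ∈ B (N p.1)} =
      ∑ i, μ (U ⁻¹' (N ⁻¹' {i})) * μ (V ⁻¹' (B i)) := by
    rw [e2, measure_iUnion _ fun i => (hN (measurableSet_singleton i)).prod (hB i), tsum_fintype]
    · refine Finset.sum_congr rfl fun i _ => ?_
      rw [Measure.prod_prod, Measure.map_apply hU' (hN (measurableSet_singleton i)),
        Measure.map_apply hV' (hB i)]
    · intro i j hij
      refine Set.disjoint_left.2 fun p h h' => hij ?_
      simp_all
  have e4 : ∑ i, ∫⁻ ω in U ⁻¹' (N ⁻¹' {i}), g ω ∂μ = ∫⁻ ω, g ω ∂μ := by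
    rw [← tsum_fintype (L := .unconditional _), ← lintegral_iUnion (fun i => h𝒜 _ (hA i)) hdisj]
    have : (⋃ i, U ⁻¹' (N ⁻¹' {i})) = Set.univ := by ext; simp
    rw [this, setLIntegral_univ]
  rw [e1, e3, ← e4, ← Finset.sum_add_distrib]
  refine (measure_iUnion_le _).trans ?_
  rw [tsum_fintype]
  exact Finset.sum_le_sum fun i _ =>
    measure_inter_le_of_dominates h𝒜 hℬ (hA i) (hV (hB i)) (hg _ (hV (hB i)))

/-- The joint law exceeds the product of the marginals by at most the `β`-dependence. -/
theorem map_prod_le_add_betaDependence (h𝒜 : 𝒜 ≤ mΩ) (hℬ : ℬ ≤ mΩ) (hU : Measurable[𝒜] U)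
    (hV : Measurable[ℬ] V) {S : Set (E × F)} (hS : MeasurableSet S) :
    μ.map (fun ω => (U ω, V ω)) S ≤
      (μ.map U).prod (μ.map V) S + betaDependence μ 𝒜 ℬ := by
  have hU' : Measurable U := hU.mono h𝒜 le_rfl
  have hV' : Measurable V := hV.mono hℬ le_rfl
  have : IsProbabilityMeasure (μ.map V) := Measure.isProbabilityMeasure_map hV'.aemeasurable
  have : IsProbabilityMeasure (μ.map U) := Measure.isProbabilityMeasure_map hU'.aemeasurable
  set P := μ.map (fun ω => (U ω, V ω))
  set Q := (μ.map U).prod (μ.map V)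
  have : IsProbabilityMeasure P :=
    Measure.isProbabilityMeasure_map (hU'.prodMk hV').aemeasurable
  apply ENNReal.le_of_forall_pos_le_add
  intro ε hε _
  -- Approximating under `P + Q` makes the symmetric difference small for both laws at once.
  obtain ⟨S', hS', hd⟩ := exists_measure_symmDiff_lt_of_generateFrom_isSetRing (μ := P + Q)
    (isSetAlgebra_rectangleAlgebra E F).isSetRing
    ⟨{Set.univ}, by simp, by simpa using (isSetAlgebra_rectangleAlgebra E F).univ_mem, by simp⟩
    (generateFrom_rectangleAlgebra E F) hS (ε := (ε : ℝ≥0∞)) (by simpa using hε)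
  have key : P (S ∆ S') + Q (S ∆ S') ≤ ε := by
    rw [symmDiff_comm]; simpa using hd.le
  have hP : P S ≤ P S' + P (S ∆ S') := by
    rw [symmDiff_comm]
    exact (measure_mono (by intro x hx; by_cases h : x ∈ S' <;> simp [Set.mem_symmDiff, *])).trans
      (measure_union_le _ _)
  have hQ : Q S' ≤ Q S + Q (S ∆ S') :=
    (measure_mono (by intro x hx; by_cases h : x ∈ S <;> simp [Set.mem_symmDiff, *])).trans
      (measure_union_le _ _)
  calc P S ≤ P S' + P (S ∆ S') := hP
    _ ≤ (Q S' + betaDependence μ 𝒜 ℬ) + P (S ∆ S') := by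
        gcongr; exact measure_rectangleAlgebra_le h𝒜 hℬ hU hV hS'
    _ ≤ (Q S + Q (S ∆ S') + betaDependence μ 𝒜 ℬ) + P (S ∆ S') := by gcongr
    _ = Q S + betaDependence μ 𝒜 ℬ + (P (S ∆ S') + Q (S ∆ S')) := by ring
    _ ≤ _ := by gcongr

end decoupling

/-! ### Hoeffding's inequality for weakly dependent sums. -/

open ProbabilityTheory in
lemma hasSubgaussianMGF_conv {ρ ν : Measure ℝ} [IsProbabilityMeasure ρ] [IsProbabilityMeasure ν]
    {c₁ c₂ : NNReal} (h₁ : HasSubgaussianMGF id c₁ ρ) (h₂ : HasSubgaussianMGF id c₂ ν) :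
    HasSubgaussianMGF id (c₁ + c₂) (ρ.conv ν) := by
  rw [Measure.conv, HasSubgaussianMGF.id_map_iff (by fun_prop)]
  refine HasSubgaussianMGF.add_of_indepFun (X := Prod.fst) (Y := Prod.snd) ?_ ?_ ?_
  · rw [← HasSubgaussianMGF.id_map_iff (by fun_prop), Measure.map_fst_prod]
    simpa using h₁
  · rw [← HasSubgaussianMGF.id_map_iff (by fun_prop), Measure.map_snd_prod]
    simpa using h₂
  · exact indepFun_prod₀ (X := id) (Y := id) aemeasurable_id aemeasurable_id

section weaklyDependentSums

variable {Ω : Type*} {mΩ : MeasurableSpace Ω} {μ : Measure Ω} [IsProbabilityMeasure μ]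

open ProbabilityTheory in
/-- The law of a sum of weakly dependent variables is dominated, up to the accumulated
`β`-dependence, by the law of the sum of independent copies. -/
lemma exists_subgaussian_dominating_law {B : ℕ → Ω → ℝ} {𝒜 ℬ : ℕ → MeasurableSpace Ω}
    {c : NNReal} {b : ℝ≥0∞} (n : ℕ) (h𝒜 : ∀ i < n, 𝒜 i ≤ mΩ) (hℬ : ∀ i < n, ℬ i ≤ mΩ)
    (hpast : ∀ i < n, Measurable[𝒜 i] fun ω => ∑ j ∈ Finset.range i, B j ω)
    (hB : ∀ i < n, Measurable[ℬ i] (B i))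
    (hβ : ∀ i < n, betaDependence μ (𝒜 i) (ℬ i) ≤ b)
    (hsub : ∀ i < n, HasSubgaussianMGF (B i) c μ) :
    ∃ ρ : Measure ℝ, IsProbabilityMeasure ρ ∧ HasSubgaussianMGF id (n * c) ρ ∧
      ∀ S, MeasurableSet S → μ.map (fun ω => ∑ j ∈ Finset.range n, B j ω) S ≤ ρ S + n * b := by
  induction n with
  | zero =>
    refine ⟨Measure.dirac 0, inferInstance, ?_, fun S hS => ?_⟩
    · simp only [Nat.cast_zero, zero_mul]
      refine HasSubgaussianMGF.zero.congr ?_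
      rw [Filter.EventuallyEq, ae_dirac_eq]
      simp
    · simp [Measure.map_const]
  | succ n ih =>
    obtain ⟨ρ, hρ, hρs, hle⟩ := ih (fun i hi => h𝒜 i (by omega)) (fun i hi => hℬ i (by omega))
      (fun i hi => hpast i (by omega)) (fun i hi => hB i (by omega)) (fun i hi => hβ i (by omega))
      (fun i hi => hsub i (by omega))
    have hBm : Measurable (B n) := (hB n n.lt_succ_self).mono (hℬ n n.lt_succ_self) le_rfl
    have hPm : Measurable fun ω => ∑ j ∈ Finset.range n, B j ω :=
      (hpast n n.lt_succ_self).mono (h𝒜 n n.lt_succ_self) le_rfl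
    have := Measure.isProbabilityMeasure_map (μ := μ) hBm.aemeasurable
    have := Measure.isProbabilityMeasure_map (μ := μ) hPm.aemeasurable
    -- The new term is first made independent of the past, at cost b; then the law of the past sum
    -- is replaced by ρ.
    refine ⟨ρ.conv (μ.map (B n)), inferInstance, ?_, fun S hS => ?_⟩
    · rw [Nat.cast_succ, add_mul, one_mul]
      exact hasSubgaussianMGF_conv hρs
        ((HasSubgaussianMGF.id_map_iff hBm.aemeasurable).2 (hsub n n.lt_succ_self))
    · have hadd : Measurable fun p : ℝ × ℝ => p.1 + p.2 := by fun_prop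
      have hS' := hadd hS
      have key := map_prod_le_add_betaDependence (μ := μ) (h𝒜 n n.lt_succ_self)
        (hℬ n n.lt_succ_self) (hpast n n.lt_succ_self) (hB n n.lt_succ_self) hS'
      have e1 : μ.map (fun ω => ∑ j ∈ Finset.range (n + 1), B j ω) S =
          μ.map (fun ω => (∑ j ∈ Finset.range n, B j ω, B n ω))
            ((fun p : ℝ × ℝ => p.1 + p.2) ⁻¹' S) := by
        rw [← Measure.map_apply hadd hS, Measure.map_map hadd (hPm.prodMk hBm)]
        simp only [Finset.sum_range_succ]
        rfl
      rw [e1]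
      refine key.trans ?_
      -- For each fixed value of the last term, the induction hypothesis applies to the
      -- corresponding slice of S.
      have e2 : (μ.map fun ω => ∑ j ∈ Finset.range n, B j ω).prod (μ.map (B n))
          ((fun p : ℝ × ℝ => p.1 + p.2) ⁻¹' S) ≤ ρ.conv (μ.map (B n)) S + n * b := by
        rw [Measure.conv, Measure.map_apply hadd hS, Measure.prod_apply_symm hS',
          Measure.prod_apply_symm hS']
        calc _ ≤ ∫⁻ y, (ρ ((fun x => (x, y)) ⁻¹' ((fun p : ℝ × ℝ => p.1 + p.2) ⁻¹' S)) + n * b)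
                ∂(μ.map (B n)) :=
              lintegral_mono fun y => hle _ (measurable_prodMk_right hS')
          _ = _ := by
              rw [lintegral_add_right _ measurable_const, lintegral_const]
              simp
      calc _ ≤ (ρ.conv (μ.map (B n)) S + n * b) + b := by
            gcongr; exact hβ n n.lt_succ_self
        _ = _ := by push_cast; ring

open ProbabilityTheory in
/-- Hoeffding's inequality for weakly dependent variables. -/
lemma measure_abs_sum_ge_le {B : ℕ → Ω → ℝ} {𝒜 ℬ : ℕ → MeasurableSpace Ω}
    {c : NNReal} {b : ℝ≥0∞} (n : ℕ) (h𝒜 : ∀ i < n, 𝒜 i ≤ mΩ) (hℬ : ∀ i < n, ℬ i ≤ mΩ)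
    (hpast : ∀ i < n, Measurable[𝒜 i] fun ω => ∑ j ∈ Finset.range i, B j ω)
    (hB : ∀ i < n, Measurable[ℬ i] (B i))
    (hβ : ∀ i < n, betaDependence μ (𝒜 i) (ℬ i) ≤ b)
    (hsub : ∀ i < n, HasSubgaussianMGF (B i) c μ) {s : ℝ} (hs : 0 ≤ s) :
    μ {ω | s ≤ |∑ j ∈ Finset.range n, B j ω|} ≤
      ENNReal.ofReal (2 * Real.exp (-s ^ 2 / (2 * (n * c)))) + n * b := by
  obtain ⟨ρ, hρ, hρs, hle⟩ := exists_subgaussian_dominating_law n h𝒜 hℬ hpast hB hβ hsub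
  have hBm : ∀ i ∈ Finset.range n, Measurable (B i) := fun i hi =>
    (hB i (Finset.mem_range.1 hi)).mono (hℬ i (Finset.mem_range.1 hi)) le_rfl
  have hm : Measurable fun ω => ∑ j ∈ Finset.range n, B j ω := Finset.measurable_fun_sum _ hBm
  have hS : MeasurableSet {x : ℝ | s ≤ |x|} := measurableSet_le measurable_const (by fun_prop)
  have h1 := hle _ hS
  rw [Measure.map_apply hm hS] at h1
  refine h1.trans ?_
  gcongr
  have hsplit : {x : ℝ | s ≤ |x|} ⊆ {x | s ≤ id x} ∪ {x | s ≤ (-id) x} := by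
    intro x hx
    exact le_abs.1 (show s ≤ |x| from hx)
  have t1 := hρs.measure_ge_le hs
  have t2 := hρs.neg.measure_ge_le hs
  push_cast at t1 t2
  rw [← ofReal_measureReal]
  apply ENNReal.ofReal_le_ofReal
  calc ρ.real {x : ℝ | s ≤ |x|} ≤ ρ.real {x | s ≤ id x} + ρ.real {x | s ≤ (-id) x} :=
        (measureReal_mono hsplit).trans (measureReal_union_le _ _)
    _ ≤ _ := by linarith

end weaklyDependentSums

/-! ### Bounded functions of a β-mixing array, by residue classes. -/

/-- Serves the first term of a residue class, which has no past; `betaDependence_bot_right` serves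
the zero terms with index beyond T. -/
lemma betaDependence_bot_left {Ω : Type*} {ℬ mΩ : MeasurableSpace Ω} (μ : Measure Ω)
    [IsProbabilityMeasure μ] (hℬ : ℬ ≤ mΩ) :
    betaDependence μ ⊥ ℬ = 0 := by
  refine le_antisymm ?_ bot_le
  refine (iInf₂_le (fun _ => 0) ⟨measurable_const, fun B hB => ae_of_all _ fun ω => ?_⟩).trans
    (by simp)
  rw [condExp_bot, integral_indicator (hℬ _ hB)]
  simp

lemma betaDependence_bot_right {Ω : Type*} {𝒜 mΩ : MeasurableSpace Ω} (μ : Measure Ω)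
    [IsProbabilityMeasure μ] (h𝒜 : 𝒜 ≤ mΩ) :
    betaDependence μ 𝒜 ⊥ = 0 := by
  refine le_antisymm ?_ bot_le
  refine (iInf₂_le (fun _ => 0) ⟨measurable_const, fun B hB => ae_of_all _ fun ω => ?_⟩).trans
    (by simp)
  rcases MeasurableSpace.measurableSet_bot_iff.1 hB with rfl | rfl
  · simp
  · simp [condExp_const h𝒜]

/-- All classes are padded with zeros to the common length T, which avoids counting their actual
members. -/
lemma sum_Icc_one_eq_sum_residues {M : Type*} [AddCommMonoid M] (F : ℕ → M) {T k : ℕ}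
    (hk : 1 ≤ k) (hF : ∀ t, T < t → F t = 0) :
    ∑ t ∈ Finset.Icc 1 T, F t =
      ∑ i ∈ Finset.range k, ∑ j ∈ Finset.range T, F (1 + i + j * k) := by
  have h1 : ∀ n, ∑ t ∈ Finset.range (n * k), F (1 + t) =
      ∑ j ∈ Finset.range n, ∑ i ∈ Finset.range k, F (1 + i + j * k) := by
    intro n
    induction n with
    | zero => simp
    | succ n ih =>
      rw [Nat.succ_mul, Finset.sum_range_add, ih, Finset.sum_range_succ]
      congr 1
      exact Finset.sum_congr rfl fun i _ => by congr 1; ring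
  rw [Finset.sum_comm, ← h1, ← Finset.sum_subset (s₁ := Finset.range T)
    (f := fun t => F (1 + t))]
  · rw [Finset.range_eq_Ico, Finset.sum_Ico_add F 0 T 1]
    rfl
  · exact Finset.range_subset_range.2 (Nat.le_mul_of_pos_right _ hk)
  · intro t _ ht
    exact hF _ (by simp at ht; omega)

section mixing

variable {Ω E : Type*} {mΩ : MeasurableSpace Ω} {μ : Measure Ω}
  [MeasurableSpace E] {Z : ℕ → ℕ → Ω → E} {T : ℕ}

lemma sigmaBlock_le (hZ : ∀ t, 1 ≤ t → t ≤ T → Measurable (Z t T)) {a b : ℕ} (ha : 1 ≤ a)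
    (hb : b ≤ T) : sigmaBlock Z T a b ≤ mΩ := by
  refine iSup₂_le fun s hs => ?_
  rw [Finset.mem_Icc] at hs
  exact (hZ s (ha.trans hs.1) (hs.2.trans hb)).comap_le

lemma measurable_sigmaBlock {a b t : ℕ} (ha : a ≤ t) (hb : t ≤ b) :
    Measurable[sigmaBlock Z T a b] (Z t T) :=
  (comap_measurable (Z t T)).mono
    (le_iSup₂_of_le t (Finset.mem_Icc.2 ⟨ha, hb⟩) le_rfl) le_rfl

lemma betaDependence_sigmaBlock_le {t k : ℕ} (ht : 1 ≤ t) (htk : t + k ≤ T) :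
    betaDependence μ (sigmaBlock Z T 1 t) (sigmaBlock Z T (t + k) T) ≤ betaMixing μ Z k :=
  le_iSup₂_of_le T t (le_iSup₂_of_le ht htk le_rfl)

/-- Hoeffding's inequality along the residue classes modulo `k` for bounded functions of a
`β`-mixing array. -/
lemma measure_abs_sum_Icc_ge_le [IsProbabilityMeasure μ]
    (hZ : ∀ t, 1 ≤ t → t ≤ T → Measurable (Z t T))
    {g : ℕ → E → ℝ} (hg : ∀ t, Measurable (g t)) {M : ℝ} (hM : ∀ t z, |g t z| ≤ M)
    {a b k : ℕ} (ha : 1 ≤ a) (hb : b ≤ T) (hk : 1 ≤ k) {s : ℝ} (hs : 0 < s) :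
    μ {ω | s ≤ |∑ t ∈ Finset.Icc a b, (g t (Z t T ω) - ∫ ω', g t (Z t T ω') ∂μ)|} ≤
      k * (ENNReal.ofReal (2 * Real.exp (-(s / k) ^ 2 / (2 * (T * M ^ 2)))) +
        T * betaMixing μ Z k) := by
  classical
  set F : ℕ → Ω → ℝ := fun t ω =>
    if t ∈ Finset.Icc a b then g t (Z t T ω) - ∫ ω', g t (Z t T ω') ∂μ else 0 with hFdef
  have hFz : ∀ t, t ∉ Finset.Icc a b → F t = fun _ => 0 := fun t ht => by
    funext ω; simp only [hFdef, if_neg ht]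
  have hFe : ∀ t, t ∈ Finset.Icc a b →
      F t = fun ω => g t (Z t T ω) - ∫ ω', g t (Z t T ω') ∂μ := fun t ht => by
    funext ω; simp only [hFdef, if_pos ht]
  have hFm : ∀ t p q, p ≤ t → t ≤ q → Measurable[sigmaBlock Z T p q] (F t) := by
    intro t p q hp hq
    by_cases ht : t ∈ Finset.Icc a b
    · rw [hFe t ht]
      exact ((hg t).comp (measurable_sigmaBlock hp hq)).sub_const _
    · rw [hFz t ht]
      exact measurable_const
  have hM0 : 0 ≤ M := by
    obtain ⟨ω⟩ : Nonempty Ω := μ.nonempty_of_neZero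
    exact (abs_nonneg _).trans (hM 0 (Z 0 T ω))
  have hsub : ∀ t, ProbabilityTheory.HasSubgaussianMGF (F t) (M.toNNReal ^ 2) μ := by
    intro t
    by_cases ht : t ∈ Finset.Icc a b
    · rw [hFe t ht]
      have ht' := Finset.mem_Icc.1 ht
      -- Hoeffding's lemma on [-M, M]: the parameter is the squared half-length M².
      have := ProbabilityTheory.hasSubgaussianMGF_of_mem_Icc (μ := μ) (a := -M) (b := M)
        (X := fun ω => g t (Z t T ω))
        ((hg t).comp (hZ t (ha.trans ht'.1) (ht'.2.trans hb))).aemeasurable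
        (ae_of_all _ fun ω => abs_le.1 (hM t _))
      convert this using 2
      ext
      simp only [Real.coe_toNNReal _ hM0, NNReal.coe_div, coe_nnnorm, Real.norm_eq_abs]
      rw [abs_of_nonneg (by linarith)]
      push_cast
      ring
    · rw [hFz t ht]
      exact { integrable_exp_mul := fun u => by simp
              mgf_le := fun u => by
                simp only [ProbabilityTheory.mgf, mul_zero, Real.exp_zero, integral_const,
                  probReal_univ, smul_eq_mul, mul_one]
                exact Real.one_le_exp (by positivity) }
  have hsum : ∀ ω, ∑ t ∈ Finset.Icc a b, (g t (Z t T ω) - ∫ ω', g t (Z t T ω') ∂μ) =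
      ∑ i ∈ Finset.range k, ∑ j ∈ Finset.range T, F (1 + i + j * k) ω := by
    intro ω
    rw [← sum_Icc_one_eq_sum_residues (fun t => F t ω) hk fun t ht => by
      rw [hFz t (by simp; omega)]]
    rw [← Finset.sum_subset (s₁ := Finset.Icc a b)
      (Finset.Icc_subset_Icc ha hb) fun t _ ht => by rw [hFz t ht]]
    exact Finset.sum_congr rfl fun t ht => by rw [hFe t ht]
  have hclass : ∀ i ∈ Finset.range k,
      μ {ω | s / k ≤ |∑ j ∈ Finset.range T, F (1 + i + j * k) ω|} ≤
      ENNReal.ofReal (2 * Real.exp (-(s / k) ^ 2 / (2 * (T * M ^ 2)))) +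
        T * betaMixing μ Z k := by
    intro i _
    -- The past of the j-th term ends at the previous member of its class, exactly k indices
    -- earlier. Once the index exceeds T the term vanishes, so the trivial σ-field can serve as its
    -- ℬ.
    have := measure_abs_sum_ge_le (μ := μ) (B := fun j => F (1 + i + j * k))
      (𝒜 := fun j => if j = 0 then ⊥ else
        if 1 + i + j * k ≤ T then sigmaBlock Z T 1 (1 + i + (j - 1) * k) else sigmaBlock Z T 1 T)
      (ℬ := fun j => if 1 + i + j * k ≤ T then sigmaBlock Z T (1 + i + j * k) T else ⊥)
      (c := M.toNNReal ^ 2) (b := betaMixing μ Z k) T ?_ ?_ ?_ ?_ ?_ (fun j _ => hsub _)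
      (s := s / k) (by positivity)
    · simpa [Real.coe_toNNReal _ hM0] using this
    · intro j _
      split_ifs with h1 h2
      · exact bot_le
      · refine sigmaBlock_le hZ le_rfl (le_trans ?_ h2)
        gcongr; omega
      · exact sigmaBlock_le hZ le_rfl le_rfl
    · intro j _
      split_ifs with h1
      · exact sigmaBlock_le hZ (by omega) le_rfl
      · exact bot_le
    · intro j _
      by_cases h1 : j = 0
      · subst h1; simp
      rw [if_neg h1]
      by_cases h2 : 1 + i + j * k ≤ T
      · rw [if_pos h2]
        refine Finset.measurable_fun_sum _ fun l hl => hFm (1 + i + l * k) 1 _ (by omega) ?_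
        have := Finset.mem_range.1 hl
        gcongr; omega
      · rw [if_neg h2]
        refine Finset.measurable_fun_sum _ fun l hl => ?_
        by_cases h3 : 1 + i + l * k ≤ T
        · exact hFm (1 + i + l * k) 1 _ (by omega) h3
        · rw [hFz (1 + i + l * k) (by simp; omega)]
          exact measurable_const
    · intro j _
      by_cases h1 : 1 + i + j * k ≤ T
      · rw [if_pos h1]
        exact hFm _ _ _ le_rfl h1
      · rw [hFz (1 + i + j * k) (by simp; omega)]
        exact measurable_const
    · intro j _
      split_ifs with h1 h2 h2
      · rw [betaDependence_bot_left μ (sigmaBlock_le hZ (by omega) le_rfl)]; exact bot_le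
      · rw [betaDependence_bot_left μ bot_le]; exact bot_le
      · obtain ⟨l, rfl⟩ := Nat.exists_eq_succ_of_ne_zero h1
        have e : 1 + i + (l + 1) * k = 1 + i + l * k + k := by ring
        simp only [Nat.succ_eq_add_one, Nat.add_sub_cancel, e] at h2 ⊢
        exact betaDependence_sigmaBlock_le (by omega) h2
      · rw [betaDependence_bot_right μ (sigmaBlock_le hZ le_rfl le_rfl)]; exact bot_le
  -- If all k class sums were below s/k in absolute value, the total would be below s.
  have hsubset : {ω | s ≤ |∑ t ∈ Finset.Icc a b, (g t (Z t T ω) - ∫ ω', g t (Z t T ω') ∂μ)|} ⊆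
      ⋃ i ∈ Finset.range k, {ω | s / k ≤ |∑ j ∈ Finset.range T, F (1 + i + j * k) ω|} := by
    intro ω hω
    simp only [Set.mem_ofPred_eq, hsum] at hω
    by_contra hcon
    simp only [Set.mem_iUnion, Set.mem_ofPred_eq, not_exists, not_le] at hcon
    have h1 := Finset.abs_sum_le_sum_abs (fun i => ∑ j ∈ Finset.range T, F (1 + i + j * k) ω)
      (Finset.range k)
    have h2 := Finset.sum_lt_sum_of_nonempty (s := Finset.range k) ⟨0, by simp; omega⟩ hcon
    rw [Finset.sum_const, Finset.card_range, nsmul_eq_mul] at h2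
    have : (k : ℝ) * (s / k) = s := by field_simp
    linarith
  refine (measure_mono hsubset).trans ((measure_biUnion_finset_le _ _).trans ?_)
  refine (Finset.sum_le_sum hclass).trans ?_
  rw [Finset.sum_const, Finset.card_range, nsmul_eq_mul]

end mixing

/-! ### Sums whose terms also depend on one member of the array. -/

section decoupledSums

variable {Ω E : Type*} {mΩ : MeasurableSpace Ω} {μ : Measure Ω} [IsProbabilityMeasure μ]
  [MeasurableSpace E] {Z : ℕ → ℕ → Ω → E} {T : ℕ}

/-- If `β(U, V)` or `β(V, U)` is small, a bound that holds for each fixed value of `U` holds, up to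
the `β`-dependence, when that value is the random one. -/
lemma measure_decouple_le {Ω E F : Type*} [MeasurableSpace E] [MeasurableSpace F]
    {𝒜 ℬ mΩ : MeasurableSpace Ω} {μ : Measure Ω} [IsProbabilityMeasure μ] (h𝒜 : 𝒜 ≤ mΩ) (hℬ : ℬ ≤ mΩ) {U : Ω → E} {V : Ω → F}
    (hU : Measurable[𝒜] U) (hV : Measurable[ℬ] V) {S : Set (E × F)} (hS : MeasurableSet S)
    {q b : ℝ≥0∞} (hq : ∀ x, μ {ω | (x, V ω) ∈ S} ≤ q)
    (hb : betaDependence μ 𝒜 ℬ ≤ b ∨ betaDependence μ ℬ 𝒜 ≤ b) :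
    μ {ω | (U ω, V ω) ∈ S} ≤ q + b := by
  have hU' : Measurable U := hU.mono h𝒜 le_rfl
  have hV' : Measurable V := hV.mono hℬ le_rfl
  have : IsProbabilityMeasure (μ.map V) := Measure.isProbabilityMeasure_map hV'.aemeasurable
  have : IsProbabilityMeasure (μ.map U) := Measure.isProbabilityMeasure_map hU'.aemeasurable
  have hprod : (μ.map U).prod (μ.map V) S ≤ q := by
    rw [Measure.prod_apply hS]
    calc _ ≤ ∫⁻ _, q ∂(μ.map U) := lintegral_mono fun x => by
            rw [Measure.map_apply hV' (measurable_prodMk_left hS)]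
            exact hq x
      _ = q := by simp
  -- The β-dependence as defined conditions on its first argument, and the mixing coefficient always
  -- puts the past there; the swapped case covers a parameter that lies after the block.
  rcases hb with hb | hb
  · have := map_prod_le_add_betaDependence (μ := μ) h𝒜 hℬ hU hV hS
    rw [Measure.map_apply (hU'.prodMk hV') hS] at this
    exact this.trans (add_le_add hprod hb)
  · have := map_prod_le_add_betaDependence (μ := μ) hℬ h𝒜 hV hU (measurable_swap hS)
    rw [Measure.map_apply (hV'.prodMk hU') (measurable_swap hS),
      ← Measure.map_apply measurable_swap hS, Measure.prod_swap] at this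
    exact this.trans (add_le_add hprod hb)

variable {g : ℕ → E → E → ℝ} {M δ s : ℝ} {k : ℕ}

/-- Sums over a block that is separated from the random parameter `Z r T`. -/
lemma measure_abs_separated_sum_ge_le (hZ : ∀ t, 1 ≤ t → t ≤ T → Measurable (Z t T))
    (hg : ∀ t, Measurable fun p : E × E => g t p.1 p.2) (hM : ∀ t x z, |g t x z| ≤ M)
    (hδ : ∀ t x, 1 ≤ t → t ≤ T → |∫ ω, g t x (Z t T ω) ∂μ| ≤ δ) (hk : 1 ≤ k) (hs : 0 < s)
    {a b r : ℕ} (ha : 1 ≤ a) (hb : b ≤ T) (hab : a ≤ b) (hr : 1 ≤ r) (hrT : r ≤ T)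
    (hsep : r + k ≤ a ∨ b + k ≤ r) :
    μ {ω | s + T * δ ≤ |∑ t ∈ Finset.Icc a b, g t (Z r T ω) (Z t T ω)|} ≤
      k * (ENNReal.ofReal (2 * Real.exp (-(s / k) ^ 2 / (2 * (T * M ^ 2)))) +
        T * betaMixing μ Z k) + betaMixing μ Z k := by
  set S : Set (E × (Finset.Icc a b → E)) :=
    {p | s + T * δ ≤ |∑ t : Finset.Icc a b, g t p.1 (p.2 t)|}
  have hS : MeasurableSet S := by
    refine measurableSet_le measurable_const (Measurable.abs ?_)
    refine Finset.measurable_fun_sum _ fun t _ => ?_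
    exact (hg t).comp (measurable_fst.prodMk ((measurable_pi_apply t).comp measurable_snd))
  have hsum : ∀ x ω, ∑ t : Finset.Icc a b, g t x (Z t T ω) =
      ∑ t ∈ Finset.Icc a b, g t x (Z t T ω) := fun x ω =>
    Finset.sum_coe_sort (Finset.Icc a b) fun t => g t x (Z t T ω)
  have hpre : ∀ (x : Ω → E), {ω | s + T * δ ≤ |∑ t ∈ Finset.Icc a b, g t (x ω) (Z t T ω)|} =
      {ω | (x ω, fun t : Finset.Icc a b => Z t T ω) ∈ S} := by
    intro x
    ext ω
    change _ ↔ s + T * δ ≤ |∑ t : Finset.Icc a b, g t (x ω) (Z t T ω)|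
    rw [hsum]
    rfl
  rw [hpre fun ω => Z r T ω]
  have hcard : ((Finset.Icc a b).card : ℝ) ≤ T := by
    have : (Finset.Icc a b).card ≤ T := by rw [Nat.card_Icc]; omega
    exact_mod_cast this
  have hδ0 : 0 ≤ δ := by
    obtain ⟨ω⟩ : Nonempty Ω := μ.nonempty_of_neZero
    exact (abs_nonneg _).trans (hδ 1 (Z 0 T ω) le_rfl (by omega))
  have hfix : ∀ x, μ {ω | (x, fun t : Finset.Icc a b => Z t T ω) ∈ S} ≤
      k * (ENNReal.ofReal (2 * Real.exp (-(s / k) ^ 2 / (2 * (T * M ^ 2)))) +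
        T * betaMixing μ Z k) := by
    intro x
    rw [← hpre fun _ => x]
    refine (measure_mono ?_).trans (measure_abs_sum_Icc_ge_le hZ
      (fun t => (hg t).comp (measurable_const (a := x) |>.prodMk measurable_id))
      (fun t => hM t x) ha hb hk hs)
    intro ω hω
    simp only [Set.mem_ofPred_eq] at hω ⊢
    rw [Finset.sum_sub_distrib]
    -- The terms with x fixed are only nearly centred; their means account for the summand `T * δ`.
    have h1 : |∑ t ∈ Finset.Icc a b, ∫ ω', g t x (Z t T ω') ∂μ| ≤ T * δ := by
      refine (Finset.abs_sum_le_sum_abs _ _).trans ?_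
      refine (Finset.sum_le_card_nsmul _ _ δ fun t ht => ?_).trans ?_
      · have := Finset.mem_Icc.1 ht
        exact hδ t x (by omega) (by omega)
      · rw [nsmul_eq_mul]
        gcongr
    have h2 := abs_sub_abs_le_abs_sub (∑ t ∈ Finset.Icc a b, g t x (Z t T ω))
      (∑ t ∈ Finset.Icc a b, ∫ ω', g t x (Z t T ω') ∂μ)
    simp only [Function.comp_apply, id] at *
    linarith
  have hV : ∀ {p q : ℕ}, p ≤ a → b ≤ q →
      Measurable[sigmaBlock Z T p q] fun ω (t : Finset.Icc a b) => Z t T ω := fun hp hq =>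
    @measurable_pi_lambda _ _ _ (sigmaBlock Z T _ _) _ _ fun t =>
      measurable_sigmaBlock (hp.trans (Finset.mem_Icc.1 t.2).1) ((Finset.mem_Icc.1 t.2).2.trans hq)
  rcases hsep with hsep | hsep
  · refine measure_decouple_le (𝒜 := sigmaBlock Z T 1 r) (ℬ := sigmaBlock Z T (r + k) T)
      (sigmaBlock_le hZ le_rfl hrT) (sigmaBlock_le hZ (by omega) le_rfl)
      (measurable_sigmaBlock hr le_rfl) (hV (by omega) hb) hS hfix
      (Or.inl (betaDependence_sigmaBlock_le hr (by omega)))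
  · refine measure_decouple_le (𝒜 := sigmaBlock Z T (b + k) T) (ℬ := sigmaBlock Z T 1 b)
      (sigmaBlock_le hZ (by omega) le_rfl) (sigmaBlock_le hZ le_rfl hb)
      (measurable_sigmaBlock hsep hrT) (hV ha le_rfl) hS hfix
      (Or.inr (betaDependence_sigmaBlock_le (by omega) (by omega)))

/-- Deviation bound for sums of bounded functions of a `β`-mixing array and one of its members. -/
theorem measure_abs_sum_random_parameter_gt_le
    (hZ : ∀ t, 1 ≤ t → t ≤ T → Measurable (Z t T))
    (hg : ∀ t, Measurable fun p : E × E => g t p.1 p.2) (hM : ∀ t x z, |g t x z| ≤ M)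
    (hδ : ∀ t x, 1 ≤ t → t ≤ T → |∫ ω, g t x (Z t T ω) ∂μ| ≤ δ) (hk : 1 ≤ k) (hs : 0 < s)
    {r : ℕ} (hr : 1 ≤ r) (hrT : r ≤ T) :
    μ {ω | 2 * (s + T * δ) + 2 * k * M < |∑ t ∈ Finset.Icc 1 T, g t (Z r T ω) (Z t T ω)|} ≤
      2 * (k * (ENNReal.ofReal (2 * Real.exp (-(s / k) ^ 2 / (2 * (T * M ^ 2)))) +
        T * betaMixing μ Z k) + betaMixing μ Z k) := by
  have hM0 : 0 ≤ M := by
    obtain ⟨ω⟩ : Nonempty Ω := μ.nonempty_of_neZero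
    exact (abs_nonneg _).trans (hM 0 (Z 0 T ω) (Z 0 T ω))
  have hδ0 : 0 ≤ δ := by
    obtain ⟨ω⟩ : Nonempty Ω := μ.nonempty_of_neZero
    exact (abs_nonneg _).trans (hδ 1 (Z 0 T ω) le_rfl (by omega))
  set q := k * (ENNReal.ofReal (2 * Real.exp (-(s / k) ^ 2 / (2 * (T * M ^ 2)))) +
        T * betaMixing μ Z k) + betaMixing μ Z k
  have hpos : 0 < s + T * δ := by positivity
  have hright : μ {ω | s + T * δ ≤ |∑ t ∈ Finset.Icc (r + k) T, g t (Z r T ω) (Z t T ω)|} ≤ q := by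
    by_cases h : r + k ≤ T
    · exact measure_abs_separated_sum_ge_le hZ hg hM hδ hk hs (by omega) le_rfl h hr hrT
        (Or.inl le_rfl)
    · rw [Finset.Icc_eq_empty h]
      simp [hpos.not_ge]
  have hleft : μ {ω | s + T * δ ≤ |∑ t ∈ Finset.Icc 1 (r - k), g t (Z r T ω) (Z t T ω)|} ≤ q := by
    by_cases h : 1 ≤ r - k
    · exact measure_abs_separated_sum_ge_le hZ hg hM hδ hk hs le_rfl (by omega) h hr hrT
        (Or.inr (by omega))
    · rw [Finset.Icc_eq_empty h]
      simp [hpos.not_ge]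
  rw [two_mul q]
  refine le_trans (measure_mono ?_) ((measure_union_le _ _).trans (add_le_add hleft hright))
  intro ω hω
  simp only [Set.mem_union, Set.mem_ofPred_eq] at hω ⊢
  by_contra! hcon
  obtain ⟨h1, h2⟩ := hcon
  set f : ℕ → ℝ := fun t => g t (Z r T ω) (Z t T ω)
  -- Indices within distance less than k of r cannot be decoupled from `Z r T`; there are at most 2k
  -- - 1 of them, each contributing at most M.
  set N := (Finset.Icc 1 T).filter fun t => r < t + k ∧ t < r + k
  have hsplit : ∑ t ∈ Finset.Icc 1 T, f t =
      ∑ t ∈ Finset.Icc 1 (r - k), f t + ∑ t ∈ Finset.Icc (r + k) T, f t + ∑ t ∈ N, f t := by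
    rw [← Finset.sum_union, ← Finset.sum_union]
    · refine Finset.sum_congr ?_ fun _ _ => rfl
      ext t
      simp only [N, Finset.mem_union, Finset.mem_Icc, Finset.mem_filter]
      omega
    · rw [Finset.disjoint_left]
      intro t
      simp only [N, Finset.mem_union, Finset.mem_Icc, Finset.mem_filter]
      omega
    · rw [Finset.disjoint_left]
      intro t
      simp only [Finset.mem_Icc]
      omega
  have hN : (N.card : ℝ) ≤ 2 * k := by
    have : N.card ≤ (Finset.Ico (r + 1 - k) (r + k)).card := Finset.card_le_card fun t => by
      simp only [N, Finset.mem_Ico, Finset.mem_Icc, Finset.mem_filter]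
      omega
    rw [Nat.card_Ico] at this
    have h3 : N.card ≤ 2 * k := by omega
    exact_mod_cast h3
  have h3 : |∑ t ∈ N, f t| ≤ 2 * k * M := by
    refine (Finset.abs_sum_le_sum_abs _ _).trans ?_
    refine (Finset.sum_le_card_nsmul _ _ M fun t _ => hM _ _ _).trans ?_
    rw [nsmul_eq_mul]
    gcongr
  rw [hsplit] at hω
  have h4 := abs_add_three (∑ t ∈ Finset.Icc 1 (r - k), f t) (∑ t ∈ Finset.Icc (r + k) T, f t)
    (∑ t ∈ N, f t)
  linarith

end decoupledSums

/-! ### The deterministic oracle inequality. -/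

section lasso

variable {d T : ℕ} {K₁ K₂ : ℝ → ℝ} {h lam : ℝ} {x : ℕ → Fin d → ℝ} {y e : ℕ → ℝ}
  {mstar : ℝ → (Fin d → ℝ) → ℝ}

/-- The interaction `∑_t e_t K₁((t/T - r/T)/h) K₂((x_t^j - x_r^j)/h)` of the noise with one
dictionary element. -/
noncomputable def noiseInteraction (K₁ K₂ : ℝ → ℝ) (h : ℝ) (T : ℕ) (x : ℕ → Fin d → ℝ)
    (e : ℕ → ℝ) (r : ℕ) (j : Fin d) : ℝ :=
  ∑ t ∈ Finset.Icc 1 T,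
    K₁ (((t : ℝ) / T - (r : ℝ) / T) / h) * K₂ ((x t j - x r j) / h) * e t

lemma sum_noise_mul_candidate (θ : Fin T → Fin d → ℝ) :
    ∑ t ∈ Finset.Icc 1 T, e t * candidate K₁ K₂ h T x θ ((t : ℝ) / T) (x t) =
      ∑ r, ∑ j, θ r j * noiseInteraction K₁ K₂ h T x e (r + 1) j := by
  simp only [candidate, noiseInteraction, Finset.mul_sum]
  rw [Finset.sum_comm]
  refine Finset.sum_congr rfl fun r _ => ?_
  rw [Finset.sum_comm]
  exact Finset.sum_congr rfl fun j _ => Finset.sum_congr rfl fun t _ => by ring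

/-- Duality of ℓ¹ and ℓ^∞: the noise enters linearly in θ, with the interactions as coefficients. -/
lemma abs_noise_mul_candidate_le
    (hG : ∀ (r : Fin T) j, |2 / (T : ℝ) * noiseInteraction K₁ K₂ h T x e (r + 1) j| ≤ lam)
    (θ : Fin T → Fin d → ℝ) :
    |2 / (T : ℝ) * ∑ t ∈ Finset.Icc 1 T, e t * candidate K₁ K₂ h T x θ ((t : ℝ) / T) (x t)| ≤
      lam * l1Norm θ := by
  rw [sum_noise_mul_candidate, l1Norm]
  simp only [Finset.mul_sum]
  refine (Finset.abs_sum_le_sum_abs _ _).trans (Finset.sum_le_sum fun r _ => ?_)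
  refine (Finset.abs_sum_le_sum_abs _ _).trans (Finset.sum_le_sum fun j _ => ?_)
  rw [mul_left_comm, abs_mul, mul_comm]
  exact mul_le_mul_of_nonneg_right (hG r j) (abs_nonneg _)

/-- The last sum does not involve θ, so it cancels when two values of θ are compared. -/
lemma empiricalRisk_eq (hy : ∀ t ∈ Finset.Icc 1 T, y t = mstar ((t : ℝ) / T) (x t) + e t)
    (θ : Fin T → Fin d → ℝ) :
    empiricalRisk K₁ K₂ h T x y θ = predictionRisk K₁ K₂ h T x mstar θ -
      2 / (T : ℝ) * ∑ t ∈ Finset.Icc 1 T, e t * candidate K₁ K₂ h T x θ ((t : ℝ) / T) (x t) +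
      1 / (T : ℝ) * ∑ t ∈ Finset.Icc 1 T, (e t ^ 2 + 2 * e t * mstar ((t : ℝ) / T) (x t)) := by
  simp only [empiricalRisk, predictionRisk, Finset.mul_sum]
  rw [← Finset.sum_sub_distrib, ← Finset.sum_add_distrib]
  refine Finset.sum_congr rfl fun t ht => ?_
  rw [hy t ht]
  ring

/-- The oracle inequality of the Lasso on the event that no dictionary element interacts too much
with the noise. -/
theorem predictionRisk_le_of_isLassoEstimator
    (hy : ∀ t ∈ Finset.Icc 1 T, y t = mstar ((t : ℝ) / T) (x t) + e t)
    (hG : ∀ (r : Fin T) j, |2 / (T : ℝ) * noiseInteraction K₁ K₂ h T x e (r + 1) j| ≤ lam)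
    {θhat : Fin T → Fin d → ℝ} (hmin : IsLassoEstimator K₁ K₂ h lam T x y θhat) :
    predictionRisk K₁ K₂ h T x mstar θhat ≤
      ⨅ θ : Fin T → Fin d → ℝ,
        (predictionRisk K₁ K₂ h T x mstar θ + 2 * lam * l1Norm θ) := by
  refine le_ciInf fun θ => ?_
  have h1 := hmin θ
  rw [empiricalRisk_eq hy, empiricalRisk_eq hy] at h1
  have h2 := (abs_le.1 (abs_noise_mul_candidate_le hG θhat)).2
  have h3 := (abs_le.1 (abs_noise_mul_candidate_le hG θ)).1
  linarith

end lasso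

/-! ### Truncation of the noise. -/

section noise

/-- Truncation of a real number at the level `τ`. -/
def clamp (τ e : ℝ) : ℝ := max (-τ) (min e τ)

lemma measurable_clamp (τ : ℝ) : Measurable (clamp τ) := by unfold clamp; fun_prop

lemma abs_clamp_le {τ : ℝ} (hτ : 0 ≤ τ) (e : ℝ) : |clamp τ e| ≤ τ :=
  abs_le.2 ⟨le_max_left _ _, max_le (by linarith) (min_le_right _ _)⟩

lemma clamp_of_abs_le {τ e : ℝ} (h : |e| ≤ τ) : clamp τ e = e := by
  obtain ⟨h1, h2⟩ := abs_le.1 h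
  rw [clamp, min_eq_left h2, max_eq_right h1]

lemma abs_clamp_sub_le {τ : ℝ} (hτ : 0 ≤ τ) (e : ℝ) : |clamp τ e - e| ≤ max (|e| - τ) 0 := by
  by_cases h : |e| ≤ τ
  · simp [clamp_of_abs_le h]
  · refine le_max_of_le_left ?_
    rw [clamp]
    grind

variable {Ω : Type*} {mΩ : MeasurableSpace Ω} {μ : Measure Ω} [IsProbabilityMeasure μ]
  {ε : Ω → ℝ} {η B τ : ℝ}

/-- Layer-cake formula: the excess is above t > 0 exactly when |ε| > t + τ, so the tail bound is
integrated over (τ, ∞). -/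
lemma integral_excess_le (hε : Measurable ε) (hη : 1 < η)
    (hB : 0 ≤ B) (htail : ∀ v, 0 < v → μ.real {ω | v < |ε ω|} ≤ v ^ (-η) * B) (hτ : 0 < τ) :
    ∫ ω, max (|ε ω| - τ) 0 ∂μ ≤ B * τ ^ (1 - η) / (η - 1) := by
  have hnn : 0 ≤ᵐ[μ] fun ω => max (|ε ω| - τ) 0 := ae_of_all _ fun ω => le_max_right _ _
  have hm : Measurable fun ω => max (|ε ω| - τ) 0 := by fun_prop
  have hval : ∫ t in Set.Ioi (0 : ℝ), (t + τ) ^ (-η) * B = B * τ ^ (1 - η) / (η - 1) := by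
    have hshift := (measurePreserving_add_right volume τ).setIntegral_preimage_emb
      (measurableEmbedding_addRight τ) (fun t : ℝ => t ^ (-η)) (Set.Ioi τ)
    rw [Set.preimage_add_const_Ioi, sub_self, integral_Ioi_rpow_of_lt (by linarith) hτ] at hshift
    rw [integral_mul_const, hshift]
    have e1 : -η + 1 = -(η - 1) := by ring
    have e2 : (1 : ℝ) - η = -(η - 1) := by ring
    rw [e1, e2, neg_div_neg_eq]
    ring
  rw [integral_eq_lintegral_of_nonneg_ae hnn hm.aestronglyMeasurable,
    lintegral_eq_lintegral_meas_lt μ hnn hm.aemeasurable, ← hval]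
  refine ENNReal.toReal_le_of_le_ofReal ?_ ?_
  · exact setIntegral_nonneg measurableSet_Ioi fun t ht =>
      mul_nonneg (Real.rpow_nonneg (by linarith [Set.mem_Ioi.1 ht]) _) hB
  rw [ofReal_integral_eq_lintegral_ofReal]
  · refine setLIntegral_mono' measurableSet_Ioi fun t ht => ?_
    have ht : 0 < t := ht
    rw [← ofReal_measureReal]
    apply ENNReal.ofReal_le_ofReal
    refine le_trans (measureReal_mono fun ω hω => ?_) (htail (t + τ) (by linarith))
    simp only [Set.mem_ofPred_eq] at hω ⊢
    rcases lt_max_iff.1 hω with h | h <;> linarith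
  · exact (integrableOn_add_rpow_Ioi_of_lt (by linarith) (by linarith)).mul_const B
  · exact (ae_restrict_iff' measurableSet_Ioi).2 (ae_of_all _ fun t ht =>
      mul_nonneg (Real.rpow_nonneg (by linarith [Set.mem_Ioi.1 ht]) _) hB)

lemma integral_noise_mul_eq_zero {S : Type*} [MeasurableSpace S] {X : Ω → S} (hX : Measurable X)
    (hint : Integrable ε μ)
    (hcond : μ[ε | MeasurableSpace.comap X inferInstance] =ᵐ[μ] 0)
    {f : S → ℝ} (hf : Measurable f) {κ : ℝ} (hκ : ∀ x, |f x| ≤ κ) :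
    ∫ ω, f (X ω) * ε ω ∂μ = 0 := by
  have hsm : StronglyMeasurable[MeasurableSpace.comap X inferInstance] fun ω => f (X ω) :=
    (hf.comp (comap_measurable X)).stronglyMeasurable
  have hmul : Integrable (fun ω => f (X ω) * ε ω) μ :=
    hint.bdd_mul (c := κ) (hf.comp hX).aestronglyMeasurable (ae_of_all _ fun ω => hκ _)
  rw [← integral_condExp hX.comap_le]
  have := condExp_mul_of_stronglyMeasurable_left hsm hmul hint
  refine (integral_congr_ae (this.trans ((EventuallyEq.refl _ _).mul hcond))).trans ?_
  simp

/-- The untruncated integral vanishes by the conditional mean condition, so only the truncation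
error, dominated by the excess, remains. -/
lemma abs_integral_clamped_noise_le {S : Type*} [MeasurableSpace S] {X : Ω → S}
    (hX : Measurable X) (hε : Measurable ε) (hint : Integrable ε μ)
    (hcond : μ[ε | MeasurableSpace.comap X inferInstance] =ᵐ[μ] 0) (hη : 1 < η)
    (hB : 0 ≤ B) (htail : ∀ v, 0 < v → μ.real {ω | v < |ε ω|} ≤ v ^ (-η) * B) (hτ : 0 < τ)
    {f : S → ℝ} (hf : Measurable f) {κ : ℝ} (hκ : ∀ x, |f x| ≤ κ) (hκ0 : 0 ≤ κ) :
    |∫ ω, f (X ω) * clamp τ (ε ω) ∂μ| ≤ κ * (B * τ ^ (1 - η) / (η - 1)) := by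
  have h0 := integral_noise_mul_eq_zero hX hint hcond hf hκ
  have hmul : Integrable (fun ω => f (X ω) * ε ω) μ :=
    hint.bdd_mul (c := κ) (hf.comp hX).aestronglyMeasurable (ae_of_all _ fun ω => hκ _)
  have hclamp : Integrable (fun ω => clamp τ (ε ω)) μ :=
    Integrable.of_bound ((measurable_clamp τ).comp hε).aestronglyMeasurable τ
      (ae_of_all _ fun ω => abs_clamp_le hτ.le _)
  have hmul' : Integrable (fun ω => f (X ω) * clamp τ (ε ω)) μ :=
    hclamp.bdd_mul (c := κ) (hf.comp hX).aestronglyMeasurable (ae_of_all _ fun ω => hκ _)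
  have hex : Integrable (fun ω => max (|ε ω| - τ) 0) μ :=
    (hint.abs.sub (integrable_const τ)).pos_part
  rw [← sub_zero (∫ ω, f (X ω) * clamp τ (ε ω) ∂μ), ← h0, ← integral_sub hmul' hmul]
  calc |∫ ω, (f (X ω) * clamp τ (ε ω) - f (X ω) * ε ω) ∂μ|
      ≤ ∫ ω, |f (X ω) * clamp τ (ε ω) - f (X ω) * ε ω| ∂μ := abs_integral_le_integral_abs
    _ ≤ ∫ ω, κ * max (|ε ω| - τ) 0 ∂μ := by
        refine integral_mono (hmul'.sub hmul).abs (hex.const_mul κ) fun ω => ?_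
        dsimp only
        rw [← mul_sub, abs_mul]
        exact mul_le_mul (hκ _) (abs_clamp_sub_le hτ.le _) (abs_nonneg _) hκ0
    _ ≤ _ := by
        rw [integral_const_mul]
        exact mul_le_mul_of_nonneg_left (integral_excess_le hε hη hB htail hτ) hκ0

end noise

/-! ### High-probability bounds for the noise interactions. -/

lemma IsBasicKernel.measurable {K : ℝ → ℝ} {CK LK : ℝ} (hK : IsBasicKernel K CK LK) :
    Measurable K := by
  refine (LipschitzWith.of_dist_le_mul (K := LK.toNNReal) fun v v' => ?_).continuous.measurable
  rw [Real.dist_eq, Real.dist_eq]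
  refine (hK.lipschitz v v').trans ?_
  gcongr
  exact Real.le_coe_toNNReal LK

lemma abs_kernel_mul_le {K₁ K₂ : ℝ → ℝ} {CK₁ CK₂ LK₁ LK₂ κ : ℝ} (hK₁ : IsBasicKernel K₁ CK₁ LK₁)
    (hK₂ : IsBasicKernel K₂ CK₂ LK₂) (hκ : |CK₁| * |CK₂| ≤ κ) (u v : ℝ) : |K₁ u * K₂ v| ≤ κ := by
  rw [abs_mul]
  exact (mul_le_mul ((hK₁.bounded u).trans (le_abs_self _)) ((hK₂.bounded v).trans (le_abs_self _))
    (abs_nonneg _) (abs_nonneg _)).trans hκ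

section model

variable {Ω : Type*} {mΩ : MeasurableSpace Ω} {μ : Measure Ω} [IsProbabilityMeasure μ] {d : ℕ}
  {𝒳 : Set (Fin d → ℝ)} {mstar : ℝ → (Fin d → ℝ) → ℝ}
  {X : ℕ → ℕ → Ω → Fin d → ℝ} {ε Y : ℕ → ℕ → Ω → ℝ} {K₁ K₂ : ℝ → ℝ}
  {CK₁ CK₂ LK₁ LK₂ κ φ η₁ η₂ B h : ℝ} {T : ℕ}

lemma measure_exists_noise_gt_le {v : ℝ}
    (htail : ∀ t, 1 ≤ t → t ≤ T → μ.real {ω | v < |ε t T ω|} ≤ v ^ (-η₂) * B) :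
    μ (⋃ t ∈ Finset.Icc 1 T, {ω | v < |ε t T ω|}) ≤ ENNReal.ofReal (T * (v ^ (-η₂) * B)) := by
  refine (measure_biUnion_finset_le _ _).trans ?_
  calc ∑ t ∈ Finset.Icc 1 T, μ {ω | v < |ε t T ω|}
      ≤ ∑ t ∈ Finset.Icc 1 T, ENNReal.ofReal (v ^ (-η₂) * B) := by
        refine Finset.sum_le_sum fun t ht => ?_
        rw [Finset.mem_Icc] at ht
        rw [← ofReal_measureReal]
        exact ENNReal.ofReal_le_ofReal (htail t ht.1 ht.2)
    _ = _ := by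
        rw [Finset.sum_const, Nat.card_Icc, nsmul_eq_mul, Nat.add_sub_cancel,
          ENNReal.ofReal_mul (Nat.cast_nonneg T), ENNReal.ofReal_natCast]

lemma exists_event_of_measure_le {N : Set Ω} (hN : MeasurableSet N) {p : ℝ} (hp : 0 ≤ p)
    (h : μ N ≤ ENNReal.ofReal p) : 1 - p ≤ μ.real Nᶜ := by
  rw [probReal_compl_eq_one_sub hN]
  have : μ.real N ≤ p := ENNReal.toReal_le_of_le_ofReal hp h
  linarith

/-- A bound on the noise interactions by the largest noise. -/
lemma exists_event_noiseInteraction_le_crude (hX : IsRegressionModel μ 𝒳 mstar X ε Y)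
    (hK₁ : IsBasicKernel K₁ CK₁ LK₁) (hK₂ : IsBasicKernel K₂ CK₂ LK₂) (hκ : |CK₁| * |CK₂| ≤ κ)
    (hB : 0 ≤ B) {v : ℝ} (hv : 0 < v)
    (htail : ∀ t, 1 ≤ t → t ≤ T → ∀ v, 0 < v → μ.real {ω | v < |ε t T ω|} ≤ v ^ (-η₂) * B) :
    ∃ A : Set Ω, MeasurableSet A ∧ 1 - T * (v ^ (-η₂) * B) ≤ μ.real A ∧ ∀ ω ∈ A,
      ∀ (r : Fin T) (j : Fin d), |noiseInteraction K₁ K₂ h T (fun t => X t T ω)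
        (fun t => ε t T ω) (r + 1) j| ≤ T * (κ * v) := by
  refine ⟨(⋃ t ∈ Finset.Icc 1 T, {ω | v < |ε t T ω|})ᶜ, ?_, ?_, fun ω hω r j => ?_⟩
  · refine (Finset.measurableSet_biUnion _ fun t ht => ?_).compl
    rw [Finset.mem_Icc] at ht
    exact measurableSet_lt measurable_const (hX.measurable_noise T t ht.1 ht.2).abs
  · refine exists_event_of_measure_le (Finset.measurableSet_biUnion _ fun t ht => ?_)
      (by positivity) (measure_exists_noise_gt_le fun t h1 h2 => htail t h1 h2 v hv)
    rw [Finset.mem_Icc] at ht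
    exact measurableSet_lt measurable_const (hX.measurable_noise T t ht.1 ht.2).abs
  · simp only [Set.mem_compl_iff, Set.mem_iUnion, Set.mem_ofPred_eq, not_exists, not_lt] at hω
    rw [noiseInteraction]
    refine (Finset.abs_sum_le_sum_abs _ _).trans ?_
    refine (Finset.sum_le_card_nsmul _ _ (κ * v) fun t ht => ?_).trans ?_
    · rw [abs_mul]
      exact mul_le_mul (abs_kernel_mul_le hK₁ hK₂ hκ _ _) (hω t ht) (abs_nonneg _)
        ((by positivity : 0 ≤ |CK₁| * |CK₂|).trans hκ)
    · rw [Nat.card_Icc, nsmul_eq_mul, Nat.add_sub_cancel]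

/-- A bound on the noise interactions by truncation, decoupling and Hoeffding's inequality. -/
lemma exists_event_noiseInteraction_le (hX : IsRegressionModel μ 𝒳 mstar X ε Y)
    (hK₁ : IsBasicKernel K₁ CK₁ LK₁) (hK₂ : IsBasicKernel K₂ CK₂ LK₂) (hκ : |CK₁| * |CK₂| ≤ κ)
    (hη₂ : 1 < η₂) (hB : 0 ≤ B)
    (hmix : ∀ k : ℕ, betaMixing μ (fun t T ω => (X t T ω, ε t T ω)) k ≤
        ENNReal.ofReal (Real.exp (-φ * (k : ℝ) ^ η₁)))
    (htail : ∀ t, 1 ≤ t → t ≤ T → ∀ v, 0 < v → μ.real {ω | v < |ε t T ω|} ≤ v ^ (-η₂) * B)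
    {τ s : ℝ} {k : ℕ} (hτ : 0 < τ) (hs : 0 < s) (hk : 1 ≤ k) :
    ∃ A : Set Ω, MeasurableSet A ∧
      1 - (T * (τ ^ (-η₂) * B) +
        T * d * (2 * (k * (2 * Real.exp (-(s / k) ^ 2 / (2 * (T * (κ * τ) ^ 2))) +
          T * Real.exp (-φ * (k : ℝ) ^ η₁)) + Real.exp (-φ * (k : ℝ) ^ η₁)))) ≤ μ.real A ∧
      ∀ ω ∈ A, ∀ (r : Fin T) (j : Fin d), |noiseInteraction K₁ K₂ h T (fun t => X t T ω)
        (fun t => ε t T ω) (r + 1) j| ≤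
          2 * (s + T * (κ * (B * τ ^ (1 - η₂) / (η₂ - 1)))) + 2 * k * (κ * τ) := by
  set Z : ℕ → ℕ → Ω → (Fin d → ℝ) × ℝ := fun t T ω => (X t T ω, ε t T ω)
  -- The first pair supplies the kernel centre only; the noise is taken from the second. The factor
  -- `K₁` is deterministic.
  set g : ℕ → Fin d → ℕ → (Fin d → ℝ) × ℝ → (Fin d → ℝ) × ℝ → ℝ := fun r j t x z =>
    K₁ (((t : ℝ) / T - (r : ℝ) / T) / h) * K₂ ((z.1 j - x.1 j) / h) * clamp τ z.2 with hg
  set δ := κ * (B * τ ^ (1 - η₂) / (η₂ - 1))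
  set u := 2 * (s + T * δ) + 2 * k * (κ * τ)
  set e := Real.exp (-φ * (k : ℝ) ^ η₁)
  set q := 2 * (k * (2 * Real.exp (-(s / k) ^ 2 / (2 * (T * (κ * τ) ^ 2))) + T * e) + e)
  have hκ0 : 0 ≤ κ := (by positivity : 0 ≤ |CK₁| * |CK₂|).trans hκ
  have hZ : ∀ t, 1 ≤ t → t ≤ T → Measurable (Z t T) := fun t h1 h2 =>
    (hX.measurable_X T t h1 h2).prodMk (hX.measurable_noise T t h1 h2)
  have hgm : ∀ r j t, Measurable fun p : ((Fin d → ℝ) × ℝ) × ((Fin d → ℝ) × ℝ) =>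
      g r j t p.1 p.2 := fun r j t => by
    have h2 := hK₂.measurable
    have h3 := measurable_clamp τ
    simp only [hg]
    fun_prop
  have hgM : ∀ r j t x z, |g r j t x z| ≤ κ * τ := fun r j t x z => by
    simp only [hg]
    rw [abs_mul]
    exact mul_le_mul (abs_kernel_mul_le hK₁ hK₂ hκ _ _) (abs_clamp_le hτ.le _) (abs_nonneg _) hκ0
  have hgδ : ∀ r j t x, 1 ≤ t → t ≤ T → |∫ ω, g r j t x (Z t T ω) ∂μ| ≤ δ :=
    fun r j t x h1 h2 => by
    have hK₂m := hK₂.measurable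
    exact abs_integral_clamped_noise_le (hX.measurable_X T t h1 h2)
      (hX.measurable_noise T t h1 h2) (hX.integrable_noise T t h1 h2) (hX.condMean T t h1 h2)
      hη₂ hB (htail t h1 h2) hτ
      (f := fun z => K₁ (((t : ℝ) / T - (r : ℝ) / T) / h) * K₂ ((z j - x.1 j) / h))
      (by fun_prop) (fun z => abs_kernel_mul_le hK₁ hK₂ hκ _ _) hκ0
  -- Outside this set truncation changes nothing, so bounds on the truncated sums transfer to the
  -- interactions.
  set N₁ : Set Ω := ⋃ t ∈ Finset.Icc 1 T, {ω | τ < |ε t T ω|}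
  set W : Fin T → Fin d → Set Ω := fun r j =>
    {ω | u < |∑ t ∈ Finset.Icc 1 T, g (r + 1) j t (Z (r + 1) T ω) (Z t T ω)|} with hW
  have hN₁ : MeasurableSet N₁ := Finset.measurableSet_biUnion _ fun t ht => by
    rw [Finset.mem_Icc] at ht
    exact measurableSet_lt measurable_const (hX.measurable_noise T t ht.1 ht.2).abs
  have hWm : ∀ r j, MeasurableSet (W r j) := fun r j => by
    refine measurableSet_lt measurable_const (Measurable.abs ?_)
    refine Finset.measurable_fun_sum _ fun t ht => ?_
    rw [Finset.mem_Icc] at ht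
    exact (hgm (r + 1) j t).comp ((hZ (r + 1) (by omega) (by omega)).prodMk (hZ t ht.1 ht.2))
  have hNm : MeasurableSet (N₁ ∪ ⋃ r, ⋃ j, W r j) :=
    hN₁.union (MeasurableSet.iUnion fun r => MeasurableSet.iUnion fun j => hWm r j)
  have hq0 : 0 ≤ q := by positivity
  have hWle : ∀ r j, μ (W r j) ≤ ENNReal.ofReal q := fun r j => by
    refine (measure_abs_sum_random_parameter_gt_le hZ (hgm (r + 1) j) (hgM (r + 1) j)
      (hgδ (r + 1) j) hk hs (by omega) (by omega)).trans ?_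
    have he0 : 0 ≤ e := (Real.exp_pos _).le
    have hE0 : 0 ≤ 2 * Real.exp (-(s / k) ^ 2 / (2 * (T * (κ * τ) ^ 2))) := by positivity
    calc _ ≤ 2 * (k * (ENNReal.ofReal (2 * Real.exp (-(s / k) ^ 2 / (2 * (T * (κ * τ) ^ 2)))) +
          T * ENNReal.ofReal e) + ENNReal.ofReal e) := by
          gcongr
          · exact hmix k
          · exact hmix k
      _ = ENNReal.ofReal q := by
          rw [← ENNReal.ofReal_natCast T, ← ENNReal.ofReal_natCast k,
            ← ENNReal.ofReal_mul (Nat.cast_nonneg T), ← ENNReal.ofReal_add hE0 (by positivity),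
            ← ENNReal.ofReal_mul (Nat.cast_nonneg k), ← ENNReal.ofReal_add (by positivity) he0,
            ← ENNReal.ofReal_ofNat 2, ← ENNReal.ofReal_mul (by norm_num)]
  have hle : μ (N₁ ∪ ⋃ r, ⋃ j, W r j) ≤
      ENNReal.ofReal (T * (τ ^ (-η₂) * B) + T * d * q) := by
    rw [ENNReal.ofReal_add (by positivity) (by positivity)]
    refine (measure_union_le _ _).trans (add_le_add
      (measure_exists_noise_gt_le fun t h1 h2 => htail t h1 h2 τ hτ) ?_)
    calc μ (⋃ r, ⋃ j, W r j) ≤ ∑ r : Fin T, ∑ j : Fin d, μ (W r j) :=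
          (measure_iUnion_fintype_le _ _).trans
            (Finset.sum_le_sum fun r _ => measure_iUnion_fintype_le _ _)
      _ ≤ ∑ r : Fin T, ∑ j : Fin d, ENNReal.ofReal q :=
          Finset.sum_le_sum fun r _ => Finset.sum_le_sum fun j _ => hWle r j
      _ = ENNReal.ofReal (T * d * q) := by
          simp only [Finset.sum_const, Finset.card_univ, Fintype.card_fin, nsmul_eq_mul]
          rw [mul_assoc, ENNReal.ofReal_mul (Nat.cast_nonneg T),
            ENNReal.ofReal_mul (Nat.cast_nonneg d), ENNReal.ofReal_natCast,
            ENNReal.ofReal_natCast]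
  refine ⟨(N₁ ∪ ⋃ r, ⋃ j, W r j)ᶜ, hNm.compl,
    exists_event_of_measure_le hNm (by positivity) hle, fun ω hω r j => ?_⟩
  simp only [N₁, hW, Set.mem_compl_iff, Set.mem_union, Set.mem_iUnion, Set.mem_ofPred_eq, not_or,
    not_exists, not_lt] at hω
  refine le_trans (le_of_eq ?_) (hω.2 r j)
  rw [noiseInteraction]
  congr 1
  refine Finset.sum_congr rfl fun t ht => ?_
  simp only [hg, Z]
  rw [clamp_of_abs_le (hω.1 t ht)]

end model

/-! ### Rates, and what the parameter constraints give. -/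

section asymptotics

lemma eventually_mul_rpow_le {K b u : ℝ} (hb : b < 0) (hu : 0 < u) :
    ∀ᶠ T : ℕ in atTop, K * (T : ℝ) ^ b ≤ u := by
  have h := ((tendsto_rpow_neg_atTop (neg_pos.2 hb)).comp
    tendsto_natCast_atTop_atTop).const_mul K
  rw [mul_zero] at h
  filter_upwards [h.eventually_le_const hu] with T hT
  simpa using hT

lemma eventually_mul_rpow_mul_exp_le {K b c γ u : ℝ} (hc : 0 < c) (hγ : 0 < γ) (hu : 0 < u) :
    ∀ᶠ T : ℕ in atTop, K * (T : ℝ) ^ b * Real.exp (-c * (T : ℝ) ^ γ) ≤ u := by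
  have h := ((tendsto_rpow_mul_exp_neg_mul_atTop_nhds_zero (b / γ) c hc).comp
    ((tendsto_rpow_atTop hγ).comp tendsto_natCast_atTop_atTop)).const_mul K
  rw [mul_zero] at h
  filter_upwards [h.eventually_le_const hu] with T hT
  simp only [Function.comp_apply] at hT
  rwa [← Real.rpow_mul (Nat.cast_nonneg T), mul_div_cancel₀ _ hγ.ne', ← mul_assoc] at hT

/-- Solving the sample size condition for d gives d^c ≤ T^(w/p) (c log d)^(q/p). The power of the
logarithm costs at most a constant times d, which lowers the exponent from c to c - 1. -/
lemma rpow_sub_one_le_of_sampleSizeBound_lt {η₁ η₂ d₁ c : ℝ} (hc : 1 < c)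
    (hp : 0 < 2 + 1 / η₁ - 2 * d₁) (hq : 0 < (d₁ - 1 / η₁) * (η₂ - 1) + 1)
    (hw : 0 < (η₂ + 3) * d₁ - (η₂ + 1) / η₁ - 3) :
    ∃ M : ℝ, 0 < M ∧ ∀ d T : ℕ, 2 ≤ d → sampleSizeBound η₁ η₂ d₁ c d < T →
      (d : ℝ) ^ (c - 1) ≤
        M * (T : ℝ) ^ (((η₂ + 3) * d₁ - (η₂ + 1) / η₁ - 3) / (2 + 1 / η₁ - 2 * d₁)) := by
  set p := 2 + 1 / η₁ - 2 * d₁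
  set q := (d₁ - 1 / η₁) * (η₂ - 1) + 1
  set w := (η₂ + 3) * d₁ - (η₂ + 1) / η₁ - 3
  have hc0 : 0 < c := by linarith
  refine ⟨(c * (q / p)) ^ (q / p), by positivity, fun d T hd hT => ?_⟩
  have hd1 : (1 : ℝ) < d := by exact_mod_cast hd
  have hd0 : (0 : ℝ) < d := by linarith
  have hlog : 0 < Real.log d := Real.log_pos hd1
  have hT0 : (0 : ℝ) ≤ T := Nat.cast_nonneg T
  have hℓ : 0 < c * Real.log d := by positivity
  have h1 : (d : ℝ) ^ (c * p) / (c * Real.log d) ^ q ≤ (T : ℝ) ^ w := by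
    have h0 : (0 : ℝ) ≤ (d : ℝ) ^ (c * p) / (c * Real.log d) ^ q := by positivity
    have := Real.rpow_le_rpow (Real.rpow_nonneg h0 _) hT.le hw.le
    rwa [← Real.rpow_mul h0, one_div_mul_cancel hw.ne', Real.rpow_one] at this
  rw [div_le_iff₀ (by positivity)] at h1
  have h2 : (d : ℝ) ^ c ≤ (T : ℝ) ^ (w / p) * (c * Real.log d) ^ (q / p) := by
    have := Real.rpow_le_rpow (by positivity) h1 (one_div_pos.2 hp).le
    rwa [Real.mul_rpow (by positivity) (by positivity), ← Real.rpow_mul hd0.le,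
      ← Real.rpow_mul hT0, ← Real.rpow_mul hℓ.le, mul_assoc, mul_one_div_cancel hp.ne', mul_one,
      mul_one_div, mul_one_div] at this
  -- The exponent p/q in log d ≤ (q/p) d^(p/q) is chosen so that raising to the power q/p leaves
  -- exactly d.
  have h3 : (c * Real.log d) ^ (q / p) ≤ (c * (q / p)) ^ (q / p) * d := by
    have hl := Real.log_le_rpow_div hd0.le (ε := p / q) (by positivity)
    have hl' : c * Real.log d ≤ c * (q / p) * (d : ℝ) ^ (p / q) := by
      calc c * Real.log d ≤ c * ((d : ℝ) ^ (p / q) / (p / q)) := by gcongr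
        _ = _ := by field_simp
    have := Real.rpow_le_rpow hℓ.le hl' (by positivity : 0 ≤ q / p)
    rwa [Real.mul_rpow (x := c * (q / p)) (by positivity) (by positivity), ← Real.rpow_mul hd0.le,
      div_mul_div_cancel₀ hq.ne', div_self hp.ne', Real.rpow_one] at this
  rw [Real.rpow_sub_one hd0.ne', div_le_iff₀ hd0]
  calc (d : ℝ) ^ c ≤ (T : ℝ) ^ (w / p) * (c * Real.log d) ^ (q / p) := h2
    _ ≤ (T : ℝ) ^ (w / p) * ((c * (q / p)) ^ (q / p) * d) := by gcongr
    _ = _ := by ring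

/-- The consequences of the parameter constraints that the rates rest on. -/
lemma parameter_bounds {η₁ η₂ ϑ d₁ : ℝ} (hη₁ : 1 < η₁)
    (hη₂ : (3 * η₁ - 1) / (η₁ - 1) < η₂) (hϑ₀ : 0 < ϑ)
    (hϑ : ϑ < ((η₁ - 1) * (η₂ - 1) - 2 * η₁) / (1 + (2 * η₁ - 1) * η₂))
    (hd₁_lower : (1 + ϑ) / ((1 - ϑ) * (η₂ - 1)) + 1 / η₁ < d₁)
    (hd₁_upper : d₁ < (1 - 2 * ϑ) / (2 * (1 - ϑ)) + 1 / (2 * η₁)) :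
    3 < η₂ ∧ ϑ < 1 / 2 ∧ 0 < 2 + 1 / η₁ - 2 * d₁ ∧ 0 < (d₁ - 1 / η₁) * (η₂ - 1) + 1 ∧
      1 + ϑ < (1 / 2 - ϑ) * (η₂ - 1) ∧
      ((η₂ + 3) * d₁ - (η₂ + 1) / η₁ - 3) / (2 + 1 / η₁ - 2 * d₁) < (1 / 2 - ϑ) * η₂ - 1 := by
  have h3 : 3 < η₂ := by
    refine lt_trans ?_ hη₂
    rw [lt_div_iff₀ (by linarith)]
    linarith
  have hϑ2 : ϑ < 1 / 2 := by
    have hden : 0 < 1 + (2 * η₁ - 1) * η₂ := by nlinarith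
    refine hϑ.trans ?_
    rw [div_lt_iff₀ hden]
    nlinarith
  have e1 : 1 / (2 * η₁) = 1 / η₁ / 2 := by field_simp
  have e2 : (η₂ + 1) / η₁ = (η₂ + 1) * (1 / η₁) := by ring
  rw [e1] at hd₁_upper
  rw [e2]
  have hi : 0 < 1 / η₁ := by positivity
  generalize 1 / η₁ = i at *
  have h1ϑ : 0 < 1 - ϑ := by linarith
  have hlow : 0 < (1 + ϑ) / ((1 - ϑ) * (η₂ - 1)) := by
    have : 0 < η₂ - 1 := by linarith
    positivity
  -- In terms of y = d₁ - 1/η₁ and i = 1/η₁ the bounds on d₁, cleared of denominators, are linear in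
  -- y and i.
  obtain ⟨y, rfl⟩ : ∃ y, d₁ = y + i := ⟨d₁ - i, by ring⟩
  have hy0 : 0 < y := by linarith
  have hylow : 1 + ϑ < y * ((1 - ϑ) * (η₂ - 1)) := by
    rw [← div_lt_iff₀ (mul_pos h1ϑ (by linarith))]
    linarith
  have hyup : 2 * y * (1 - ϑ) < (1 - 2 * ϑ) - i * (1 - ϑ) := by
    have h : y < (1 - 2 * ϑ) / (2 * (1 - ϑ)) - i / 2 := by linarith
    have h' := mul_lt_mul_of_pos_right h (by linarith : 0 < 2 * (1 - ϑ))
    rw [sub_mul, div_mul_cancel₀ _ (by linarith)] at h'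
    linarith
  have hp1 : 1 < (2 + i - 2 * (y + i)) * (1 - ϑ) := by linarith
  have hp : 0 < 2 + i - 2 * (y + i) := by
    by_contra! h
    nlinarith
  -- This is the compatibility of the lower and upper bounds on y, hence of the two bounds on d₁.
  have hb : 1 + ϑ < (1 / 2 - ϑ) * (η₂ - 1) := by
    have := mul_lt_mul_of_pos_right hyup (by linarith : 0 < η₂ - 1)
    have : 0 < i * (1 - ϑ) * (η₂ - 1) := by
      have : 0 < η₂ - 1 := by linarith
      positivity
    nlinarith
  refine ⟨h3, hϑ2, hp, ?_, hb, ?_⟩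
  · have : 0 < y * (η₂ - 1) := mul_pos hy0 (by linarith)
    linarith
  · rw [div_lt_iff₀ hp]
    have hw : ((η₂ + 3) * (y + i) - (η₂ + 1) * i - 3) * (1 - ϑ) < (1 / 2 - ϑ) * η₂ - 1 := by
      have := mul_lt_mul_of_pos_right hyup (by linarith : 0 < η₂ + 3)
      have : 0 < i * (1 - ϑ) * (η₂ - 1) := by
        have : 0 < η₂ - 1 := by linarith
        positivity
      nlinarith
    have hbpos : 0 < (1 / 2 - ϑ) * η₂ - 1 := by linarith
    have := mul_lt_mul_of_pos_left hp1 hbpos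
    refine lt_of_mul_lt_mul_right ?_ h1ϑ.le
    linarith

end asymptotics

/-- Truncation level, deviation and block length with which the noise interactions are small with
high probability. -/
lemma eventually_exists_truncation {φ η₁ η₂ ϑ ξ c C κ B M w : ℝ} (hφ : 0 < φ) (hη₁ : 1 < η₁)
    (hη₂ : 3 < η₂) (hϑ : ϑ < 1 / 2) (hξ₀ : 0 < ξ) (hξ : ξ < ϑ) (hc : 1 < c)
    (hb : 1 + ϑ < (1 / 2 - ϑ) * (η₂ - 1)) (hw : w < (1 / 2 - ϑ) * η₂ - 1)
    (hC : 0 < C) (hκ : 0 < κ) (hB : 0 ≤ B) (hM : 0 < M) :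
    ∀ᶠ T : ℕ in atTop, ∀ d : ℕ, 2 ≤ d → (d : ℝ) ^ (c - 1) ≤ M * (T : ℝ) ^ w →
      ∃ (τ s : ℝ) (k : ℕ), 0 < τ ∧ 0 < s ∧ 1 ≤ k ∧
        T * (τ ^ (-η₂) * B) +
        T * d * (2 * (k * (2 * Real.exp (-(s / k) ^ 2 / (2 * (T * (κ * τ) ^ 2))) +
          T * Real.exp (-φ * (k : ℝ) ^ η₁)) + Real.exp (-φ * (k : ℝ) ^ η₁))) ≤
            (d : ℝ) ^ (1 - c) ∧
        2 * (s + T * (κ * (B * τ ^ (1 - η₂) / (η₂ - 1)))) + 2 * k * (κ * τ) ≤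
          2 * C * (T : ℝ) ^ (1 + ξ - ϑ) := by
  -- Being above 1/2 - ϑ, this exponent inherits the inequalities `hb` and `hw`. It is still small
  -- enough that, with s of order x^(1+ξ-ϑ) and k of order x^(ξ/4), the Hoeffding exponent s²/(k² x
  -- τ²) has order x^(ξ/2), more than the x^(ξ/4) needed.
  set a := 1 / 2 - ϑ + ξ / 2 with ha
  -- A common rate for the mixing and Hoeffding errors: s/k ≥ (C/4) x^(1+3ξ/4-ϑ), and (C/4)² / (2κ²)
  -- is the second entry.
  set c₁ := min φ (C ^ 2 / (32 * κ ^ 2))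
  have hc₁ : 0 < c₁ := lt_min hφ (by positivity)
  have haη : (1 / 2 - ϑ) * η₂ < a * η₂ := by
    have : 0 < ξ / 2 * η₂ := by positivity
    rw [ha]; linarith
  have haη' : (1 / 2 - ϑ) * (η₂ - 1) < a * (η₂ - 1) := by
    have : 0 < ξ / 2 * (η₂ - 1) := mul_pos (by positivity) (by linarith)
    rw [ha]; linarith
  -- After multiplication by d^(c-1), the large-noise probability and the exponential errors each
  -- get half of 1. In the deviation 2C x^(1+ξ-ϑ), `2 * s` uses half; the truncation bias and the
  -- indices near r get a quarter each.
  filter_upwards [eventually_ge_atTop 1,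
    eventually_mul_rpow_le (K := M * B) (b := w + 1 - a * η₂) (u := 1 / 2) (by linarith)
      (by norm_num),
    eventually_mul_rpow_mul_exp_le (K := 14 * M * M ^ (1 / (c - 1)))
      (b := w + w / (c - 1) + 3) (c := c₁) (γ := ξ / 4) (u := 1 / 2) hc₁ (by positivity)
      (by norm_num),
    eventually_mul_rpow_le (K := 2 * κ * B / (η₂ - 1))
      (b := 1 + a * (1 - η₂) - (1 + ξ - ϑ)) (u := C / 2) (by linarith) (by positivity),
    eventually_mul_rpow_le (K := 4 * κ)
      (b := ξ / 4 + a - (1 + ξ - ϑ)) (u := C / 2) (by rw [ha]; linarith) (by positivity)]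
    with T hT1 E1 E2 E3 E4 d hd hdT
  have hx1 : (1 : ℝ) ≤ T := by exact_mod_cast hT1
  generalize (T : ℝ) = x at *
  have hx0 : 0 < x := by linarith
  have hd0 : (0 : ℝ) < d := by exact_mod_cast (by omega : 0 < d)
  set k := ⌈x ^ (ξ / 4)⌉₊
  have hxk : 1 ≤ x ^ (ξ / 4) := Real.one_le_rpow hx1 (by positivity)
  have hk1 : x ^ (ξ / 4) ≤ k := Nat.le_ceil _
  have hk2 : (k : ℝ) ≤ 2 * x ^ (ξ / 4) := by
    have := (Nat.ceil_lt_add_one (by positivity : 0 ≤ x ^ (ξ / 4))).le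
    linarith
  have hk1' : (1 : ℝ) ≤ k := hxk.trans hk1
  have hkx : (k : ℝ) ≤ 2 * x := by
    refine hk2.trans ?_
    gcongr
    calc x ^ (ξ / 4) ≤ x ^ (1 : ℝ) := Real.rpow_le_rpow_of_exponent_le hx1 (by linarith)
      _ = x := Real.rpow_one x
  refine ⟨x ^ a, C / 2 * x ^ (1 + ξ - ϑ), k, by positivity, by positivity,
    by exact_mod_cast hk1', ?_, ?_⟩
  · set X := Real.exp (-c₁ * x ^ (ξ / 4))
    have he : Real.exp (-φ * (k : ℝ) ^ η₁) ≤ X := by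
      apply Real.exp_le_exp.2
      rw [neg_mul, neg_mul, neg_le_neg_iff]
      have : (k : ℝ) ≤ (k : ℝ) ^ η₁ := by
        simpa using Real.rpow_le_rpow_of_exponent_le hk1' hη₁.le
      exact mul_le_mul (min_le_left _ _) (hk1.trans this) (by positivity) hφ.le
    have hE : Real.exp (-(C / 2 * x ^ (1 + ξ - ϑ) / k) ^ 2 / (2 * (x * (κ * x ^ a) ^ 2))) ≤ X := by
      apply Real.exp_le_exp.2
      rw [neg_mul, neg_div, neg_le_neg_iff, le_div_iff₀ (by positivity)]
      have hy : C / 4 * x ^ (1 + 3 * ξ / 4 - ϑ) ≤ C / 2 * x ^ (1 + ξ - ϑ) / k := by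
        rw [le_div_iff₀ (by linarith)]
        calc C / 4 * x ^ (1 + 3 * ξ / 4 - ϑ) * k
            ≤ C / 4 * x ^ (1 + 3 * ξ / 4 - ϑ) * (2 * x ^ (ξ / 4)) := by gcongr
          _ = C / 2 * (x ^ (1 + 3 * ξ / 4 - ϑ) * x ^ (ξ / 4)) := by ring
          _ = C / 2 * x ^ (1 + ξ - ϑ) := by
              rw [← Real.rpow_add hx0]
              ring_nf
      refine le_trans ?_ (pow_le_pow_left₀ (by positivity) hy 2)
      have hsq : ∀ b : ℝ, (x ^ b) ^ 2 = x ^ (2 * b) := fun b => by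
        rw [← Real.rpow_natCast, ← Real.rpow_mul hx0.le]
        push_cast
        ring_nf
      calc c₁ * x ^ (ξ / 4) * (2 * (x * (κ * x ^ a) ^ 2))
          ≤ C ^ 2 / (32 * κ ^ 2) * x ^ (ξ / 4) * (2 * (x * (κ * x ^ a) ^ 2)) := by
            gcongr
            exact min_le_right _ _
        _ = C ^ 2 / 16 * (x ^ (ξ / 4) * (x ^ (1 : ℝ) * x ^ (2 * a))) := by
            rw [mul_pow, hsq, Real.rpow_one]
            field_simp
            ring
        _ = C ^ 2 / 16 * x ^ (ξ / 4 + (1 + 2 * a)) := by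
            rw [← Real.rpow_add hx0, ← Real.rpow_add hx0]
        _ ≤ C ^ 2 / 16 * x ^ (2 * (1 + 3 * ξ / 4 - ϑ)) := by
            gcongr
            rw [ha]; linarith
        _ = (C / 4 * x ^ (1 + 3 * ξ / 4 - ϑ)) ^ 2 := by
            rw [mul_pow, hsq]
            ring
    have hX0 : 0 < X := Real.exp_pos _
    have hrate : k * (2 * Real.exp (-(C / 2 * x ^ (1 + ξ - ϑ) / k) ^ 2 /
        (2 * (x * (κ * x ^ a) ^ 2))) + x * Real.exp (-φ * (k : ℝ) ^ η₁)) +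
          Real.exp (-φ * (k : ℝ) ^ η₁) ≤ 7 * x ^ 2 * X := by
      calc _ ≤ 2 * x * (2 * X + x * X) + X := by gcongr
        _ = (4 * x + 2 * x ^ 2 + 1) * X := by ring
        _ ≤ 7 * x ^ 2 * X := by
            gcongr
            nlinarith
    -- The dimension is at most polynomial in x, so the union bound cannot defeat the exponential
    -- factor.
    have hdx : (d : ℝ) ≤ M ^ (1 / (c - 1)) * x ^ (w / (c - 1)) := by
      have h := Real.rpow_le_rpow (by positivity) hdT
        (one_div_nonneg.2 (by linarith : 0 ≤ c - 1))
      rwa [← Real.rpow_mul hd0.le, mul_one_div_cancel (by linarith), Real.rpow_one,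
        Real.mul_rpow hM.le (by positivity), ← Real.rpow_mul hx0.le, mul_one_div] at h
    have hD : 0 < (d : ℝ) ^ (c - 1) := by positivity
    have e : (d : ℝ) ^ (1 - c) = 1 / (d : ℝ) ^ (c - 1) := by
      rw [one_div, ← Real.rpow_neg hd0.le, neg_sub]
    rw [e, le_div_iff₀ hD, add_mul]
    have t1 : x * ((x ^ a) ^ (-η₂) * B) * (d : ℝ) ^ (c - 1) ≤ 1 / 2 := by
      calc _ ≤ x * ((x ^ a) ^ (-η₂) * B) * (M * x ^ w) := by gcongr
        _ = M * B * (x ^ w * x ^ (1 : ℝ) * x ^ (a * -η₂)) := by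
            rw [← Real.rpow_mul hx0.le, Real.rpow_one]
            ring
        _ = M * B * x ^ (w + 1 - a * η₂) := by
            rw [← Real.rpow_add hx0, ← Real.rpow_add hx0]
            ring_nf
        _ ≤ 1 / 2 := E1
    have t2 : x * d * (2 * (k * (2 * Real.exp (-(C / 2 * x ^ (1 + ξ - ϑ) / k) ^ 2 /
        (2 * (x * (κ * x ^ a) ^ 2))) + x * Real.exp (-φ * (k : ℝ) ^ η₁)) +
          Real.exp (-φ * (k : ℝ) ^ η₁))) * (d : ℝ) ^ (c - 1) ≤ 1 / 2 := by
      calc _ ≤ x * (M ^ (1 / (c - 1)) * x ^ (w / (c - 1))) * (2 * (7 * x ^ 2 * X)) *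
            (M * x ^ w) := by gcongr
        _ = 14 * M * M ^ (1 / (c - 1)) * (x ^ w * x ^ (w / (c - 1)) * x ^ (3 : ℝ)) * X := by
            rw [show (3 : ℝ) = (3 : ℕ) by norm_num, Real.rpow_natCast]
            ring
        _ = 14 * M * M ^ (1 / (c - 1)) * x ^ (w + w / (c - 1) + 3) * X := by
            rw [← Real.rpow_add hx0, ← Real.rpow_add hx0]
        _ ≤ 1 / 2 := E2
    linarith
  · have hP : 0 < x ^ (1 + ξ - ϑ) := by positivity
    have t3 : 2 * (x * (κ * (B * (x ^ a) ^ (1 - η₂) / (η₂ - 1)))) ≤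
        C / 2 * x ^ (1 + ξ - ϑ) := by
      rw [← div_le_iff₀ hP]
      refine le_trans (le_of_eq ?_) E3
      rw [Real.rpow_sub hx0 (1 + a * (1 - η₂)), Real.rpow_add hx0 1, Real.rpow_one,
        ← Real.rpow_mul hx0.le]
      ring
    have t4 : 2 * k * (κ * x ^ a) ≤ C / 2 * x ^ (1 + ξ - ϑ) := by
      refine (by gcongr : _ ≤ 2 * (2 * x ^ (ξ / 4)) * (κ * x ^ a)).trans ?_
      rw [← div_le_iff₀ hP]
      refine le_trans (le_of_eq ?_) E4
      rw [Real.rpow_sub hx0 (ξ / 4 + a), Real.rpow_add hx0 (ξ / 4) a]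
      ring
    linarith

end LSTS

/-! ### Assembly, with the case of small T. -/

theorem mainTheorem5
    (CK₁ CK₂ LK₁ LK₂ φ η₁ η₂ BL ϑ ξ d₁ c : ℝ)
    (hφ : 0 < φ) (hη₁ : 1 < η₁) (hη₂ : (3 * η₁ - 1) / (η₁ - 1) < η₂)
    (hϑ₀ : 0 < ϑ)
    (hϑ : ϑ < ((η₁ - 1) * (η₂ - 1) - 2 * η₁) / (1 + (2 * η₁ - 1) * η₂))
    (hξ₀ : 0 < ξ) (hξ : ξ < ϑ)
    (hd₁_lower : (1 + ϑ) / ((1 - ϑ) * (η₂ - 1)) + 1 / η₁ < d₁)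
    (hd₁_upper : d₁ < (1 - 2 * ϑ) / (2 * (1 - ϑ)) + 1 / (2 * η₁))
    (hd₁_exponent : 0 < (η₂ + 3) * d₁ - (η₂ + 1) / η₁ - 3)
    (hc : 1 < c) :
    ∃ (C₀ : ℝ) (T₀ : ℝ → ℕ), 0 < C₀ ∧ (∀ C, C₀ ≤ C → T₀ C = 1) ∧
      ∀ C : ℝ, 0 < C →
      ∀ K₁ K₂ : ℝ → ℝ, LSTS.IsBasicKernel K₁ CK₁ LK₁ → LSTS.IsBasicKernel K₂ CK₂ LK₂ →
      ∀ (Ω : Type*) [MeasurableSpace Ω] (μ : Measure Ω) [IsProbabilityMeasure μ]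
        (d : ℕ) (𝒳 : Set (Fin d → ℝ)) (mstar : ℝ → (Fin d → ℝ) → ℝ)
        (X : ℕ → ℕ → Ω → Fin d → ℝ) (ε Y : ℕ → ℕ → Ω → ℝ) (L : ℝ → ℝ) (h : ℕ → ℝ),
      1 ≤ d →
      LSTS.IsRegressionModel μ 𝒳 mstar X ε Y →
      LSTS.IsLocallyStationary μ X →
      (∀ k : ℕ, LSTS.betaMixing μ (fun t T ω => (X t T ω, ε t T ω)) k ≤
        ENNReal.ofReal (Real.exp (-φ * (k : ℝ) ^ η₁))) →
      (∀ T t : ℕ, 1 ≤ t → t ≤ T → LSTS.HasRegularlyVaryingTail μ (ε t T) η₂ L) →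
      (∀ v : ℝ, 0 < v → L v ≤ BL) →
      (∀ T, 0 < h T) →
      (h =O[atTop] fun T : ℕ => (T : ℝ) ^ (-ξ)) →
      ∀ T : ℕ, T₀ C ≤ T → LSTS.sampleSizeBound η₁ η₂ d₁ c d < (T : ℝ) →
      ∃ A : Set Ω, MeasurableSet A ∧ 1 - (d : ℝ) ^ (1 - c) ≤ μ.real A ∧
        ∀ ω ∈ A, ∀ θhat : Fin T → Fin d → ℝ,
          LSTS.IsLassoEstimator K₁ K₂ (h T) (LSTS.tuning C ϑ ξ T) T
            (fun t => X t T ω) (fun t => Y t T ω) θhat →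
          LSTS.predictionRisk K₁ K₂ (h T) T (fun t => X t T ω) mstar θhat ≤
            ⨅ θ : Fin T → Fin d → ℝ,
              (LSTS.predictionRisk K₁ K₂ (h T) T (fun t => X t T ω) mstar θ +
                2 * LSTS.tuning C ϑ ξ T * LSTS.l1Norm θ) := by
  obtain ⟨hη₂3, hϑ2, hp, hq, hb, hw⟩ :=
    LSTS.parameter_bounds hη₁ hη₂ hϑ₀ hϑ hd₁_lower hd₁_upper
  obtain ⟨M, hM, hdim⟩ := LSTS.rpow_sub_one_le_of_sampleSizeBound_lt hc hp hq hd₁_exponent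
  set w := ((η₂ + 3) * d₁ - (η₂ + 1) / η₁ - 3) / (2 + 1 / η₁ - 2 * d₁)
  have hw0 : 0 < w := div_pos hd₁_exponent hp
  set κ := |CK₁| * |CK₂| + 1
  have hκ : 0 < κ := by positivity
  set B := |BL|
  have hB : 0 ≤ B := abs_nonneg BL
  have hlarge : ∀ C : ℝ, 0 < C → ∃ T₁ : ℕ, ∀ T ≥ T₁, _ := fun C hC => eventually_atTop.1
    (LSTS.eventually_exists_truncation hφ hη₁ hη₂3 hϑ2 hξ₀ hξ hc hb hw hC hκ hB hM)
  choose! T₁ hT₁ using hlarge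
  -- Bounds every T not covered by the threshold for C = 1.
  set x₁ : ℝ := max 1 (T₁ 1)
  have hx₁ : 1 ≤ x₁ := le_max_left _ _
  -- For T ≤ x₁ one has d^(c-1) ≤ M x₁^w, so a level v with v^(-η₂) = 1/Q is exceeded by some noise
  -- with probability at most d^(1-c).
  set Q := x₁ * B * (M * x₁ ^ w) + 1
  have hQ : 0 < Q := by positivity
  set v := Q ^ (1 / η₂)
  have hv : 0 < v := by positivity
  have hvQ : v ^ (-η₂) = 1 / Q := by
    rw [← Real.rpow_mul hQ.le, one_div_mul_eq_div, neg_div, div_self (by linarith),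
      Real.rpow_neg_one, one_div]
  -- The first entry lets the threshold `T₁ 1` serve every C ≥ C₀; the second gives κv ≤ C T^(ξ-ϑ)
  -- for all T ≤ x₁.
  set C₀ := max 1 (κ * v * x₁ ^ (ϑ - ξ))
  classical
  refine ⟨C₀, fun C => if C₀ ≤ C then 1 else max 1 (T₁ C), by positivity,
    fun C hC => if_pos hC, ?_⟩
  intro C hC K₁ K₂ hK₁ hK₂ Ω _ μ _ d 𝒳 mstar X ε Y L h hd hX _ hmix htail hL _ _ T hT hdT
  beta_reduce at hT
  have hT1 : 1 ≤ T := by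
    split_ifs at hT with h1
    · exact hT
    · exact (le_max_left _ _).trans hT
  have hTR : (1 : ℝ) ≤ T := by exact_mod_cast hT1
  have hT0 : (0 : ℝ) < T := by linarith
  -- For d = 1 the required probability is 1 - 1 = 0, and the empty event will do.
  rcases hd.eq_or_lt with rfl | hd2
  · exact ⟨∅, .empty, by simp, by simp⟩
  have hd0 : (0 : ℝ) < d := by exact_mod_cast (by omega : 0 < d)
  have hDM := hdim d T hd2 hdT
  have htailB : ∀ t, 1 ≤ t → t ≤ T → ∀ v, 0 < v → μ.real {ω | v < |ε t T ω|} ≤ v ^ (-η₂) * B :=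
    fun t h1 h2 v hv => by
      rw [(htail T t h1 h2).2 v hv]
      gcongr
      exact (hL v hv).trans (le_abs_self BL)
  have hκ' : |CK₁| * |CK₂| ≤ κ := by simp only [κ]; linarith
  have htuning : 4 * C * (T : ℝ) ^ (ξ - ϑ) ≤ LSTS.tuning C ϑ ξ T := by
    rw [LSTS.tuning, le_div_iff₀ (by positivity), mul_assoc, ← Real.rpow_add hT0,
      show ξ - ϑ + (1 + ϑ - ξ) = 1 by ring, Real.rpow_one]
    nlinarith
  suffices key : ∃ A : Set Ω, MeasurableSet A ∧ 1 - (d : ℝ) ^ (1 - c) ≤ μ.real A ∧ ∀ ω ∈ A,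
      ∀ (r : Fin T) (j : Fin d), |LSTS.noiseInteraction K₁ K₂ (h T) T (fun t => X t T ω)
        (fun t => ε t T ω) (r + 1) j| ≤ 2 * C * (T : ℝ) ^ (1 + ξ - ϑ) by
    obtain ⟨A, hA, hμA, hbound⟩ := key
    refine ⟨A, hA, hμA, fun ω hω θhat hmin => ?_⟩
    refine LSTS.predictionRisk_le_of_isLassoEstimator (e := fun t => ε t T ω) (fun t ht => ?_)
      (fun r j => ?_) hmin
    · rw [Finset.mem_Icc] at ht
      exact hX.model T t ht.1 ht.2 ω
    · refine le_trans ?_ htuning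
      rw [abs_mul, abs_of_pos (by positivity)]
      calc _ ≤ 2 / (T : ℝ) * (2 * C * (T : ℝ) ^ (1 + ξ - ϑ)) := by
            gcongr
            exact hbound ω hω r j
        _ = 4 * C * (T : ℝ) ^ (ξ - ϑ) := by
            rw [show 1 + ξ - ϑ = 1 + (ξ - ϑ) by ring, Real.rpow_add hT0, Real.rpow_one]
            field_simp
            ring
  -- The target bound grows with C, so a threshold found for a smaller constant remains valid.
  have hbig : ∀ C' : ℝ, 0 < C' → C' ≤ C → T₁ C' ≤ T →
      ∃ A : Set Ω, MeasurableSet A ∧ 1 - (d : ℝ) ^ (1 - c) ≤ μ.real A ∧ ∀ ω ∈ A,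
      ∀ (r : Fin T) (j : Fin d), |LSTS.noiseInteraction K₁ K₂ (h T) T (fun t => X t T ω)
        (fun t => ε t T ω) (r + 1) j| ≤ 2 * C * (T : ℝ) ^ (1 + ξ - ϑ) := by
    intro C' hC' hCC hTC
    obtain ⟨τ, s, k, hτ, hs, hk, hprob, hdev⟩ := hT₁ C' hC' T hTC d hd2 hDM
    obtain ⟨A, hA, hμA, hbound⟩ := LSTS.exists_event_noiseInteraction_le (h := h T) hX hK₁ hK₂ hκ'
      (by linarith) hB hmix htailB hτ hs hk
    refine ⟨A, hA, by linarith, fun ω hω r j => (hbound ω hω r j).trans (hdev.trans ?_)⟩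
    gcongr
  by_cases hCC : C₀ ≤ C
  · by_cases hT₁T : T₁ 1 ≤ T
    · exact hbig 1 one_pos ((le_max_left _ _).trans hCC) hT₁T
    · have hTx : (T : ℝ) ≤ x₁ := by
        refine le_trans ?_ (le_max_right _ _)
        exact_mod_cast (not_le.1 hT₁T).le
      obtain ⟨A, hA, hμA, hbound⟩ := LSTS.exists_event_noiseInteraction_le_crude (h := h T)
        hX hK₁ hK₂ hκ' hB hv htailB
      refine ⟨A, hA, le_trans ?_ hμA, fun ω hω r j => (hbound ω hω r j).trans ?_⟩
      · have hD : 0 < (d : ℝ) ^ (c - 1) := by positivity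
        have e : (d : ℝ) ^ (1 - c) = 1 / (d : ℝ) ^ (c - 1) := by
          rw [one_div, ← Real.rpow_neg hd0.le, neg_sub]
        have : T * (v ^ (-η₂) * B) ≤ (d : ℝ) ^ (1 - c) := by
          rw [e, le_div_iff₀ hD, hvQ]
          calc T * (1 / Q * B) * (d : ℝ) ^ (c - 1) ≤ x₁ * (1 / Q * B) * (M * x₁ ^ w) := by
                gcongr
                exact hDM.trans (by gcongr)
            _ = (x₁ * B * (M * x₁ ^ w)) / Q := by ring
            _ ≤ 1 := by
                rw [div_le_one hQ]
                simp only [Q]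
                linarith
        linarith
      · have h1 : κ * v * x₁ ^ (ϑ - ξ) ≤ C := (le_max_right _ _).trans hCC
        have h2 : κ * v ≤ C * (T : ℝ) ^ (ξ - ϑ) := by
          have e : (T : ℝ) ^ (ξ - ϑ) = ((T : ℝ) ^ (ϑ - ξ))⁻¹ := by
            rw [← Real.rpow_neg hT0.le, neg_sub]
          rw [e, ← div_eq_mul_inv, le_div_iff₀ (by positivity)]
          refine le_trans ?_ h1
          gcongr
        rw [show 1 + ξ - ϑ = 1 + (ξ - ϑ) by ring, Real.rpow_add hT0, Real.rpow_one]
        have h3 := mul_le_mul_of_nonneg_left h2 hT0.le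
        have h4 : 0 ≤ T * (C * (T : ℝ) ^ (ξ - ϑ)) := by positivity
        linarith
  · rw [if_neg hCC] at hT
    exact hbig C hC le_rfl ((le_max_right _ _).trans hT)
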